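/- Let $K$ be a field of prime characteristic $p$, and let $\Xi=(S_i,R_i\mid i\ge 0)$ be a tuple of positive integers that is periodic: $S_{i+N}=S_i$, $R_{i+N}=R_i$ for all $i\ge 0$, where $N\ge 1$ is fixed. Let $R(\Xi)$ be the divided power algebra with $K$-basis the (finite) formal monomials $\prod_{i\ge 0}x_i^{(a_i)}y_i^{(b_i)}z_i^{(c_i)}$, $0\le a_i<p^{S_i}$, $0\le b_i,c_i<p^{R_i}$, and product determined by $t^{(a)}t^{(b)}=\binom{a+b}{a}t^{(a+b)}$ in each variable $t$; let $\partial_t$ be the derivation with $\partial_t(t^{(a)})=t^{(a-1)}$ (where $t^{(-1)}=0$) which kills the other variables. Define derivations of $R(\Xi)$ recursively by $$v_i=\partial_{x_i}+x_i^{(p^{S_i}-1)}y_i^{(p^{R_i}-1)}v_{i+1},\quad w_i=\partial_{y_i}+y_i^{(p^{R_i}-1)}x_i^{(p^{S_i}-1)}w_{i+1},\quad u_i=\partial_{z_i}+z_i^{(p^{R_i}-1)}x_i^{(p^{S_i}-1)}u_{i+1}\qquad(i\ge 0),$$ and let $T=T(\Xi)=\mathrm{Lie}_p(v_0,w_0,u_0)\subset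 \mathrm{Der}\,R(\Xi)$ be the restricted Lie algebra that they generate: the smallest subspace containing $v_0,w_0,u_0$ and closed under $[a,b]=ab-ba$ and $a\mapsto a^p$ (clover restricted Lie algebra). Put $$\mu=\prod_{i=0}^{N-1}\left(p^{S_i}+p^{R_i}-1\right),\qquad \sigma=\sum_{i=0}^{N-1}(S_i+2R_i),\qquad \lambda=\frac{\sigma\ln p}{\ln\mu}.$$ For a finite generating set $X$ of $T$ (for instance $X=\{v_0,w_0,u_0\}$), let $\gamma_T(X,m)$ be the dimension of the span of all elements $[x_1,[x_2,\dots,[x_{s-1},x_s]\dots]]^{p^k}$ with $x_j\in X$, $s\ge 1$, $k\ge 0$, $sp^k\le m$. Then: 1. For every finite generating set $X$ of $T$, $$\limsup_{m\to\infty}\frac{\ln\gamma_T(X,m)}{\ln m}=\liminf_{m\to\infty}\frac{\ln\gamma_T(X,m)}{\ln m}=\lambda,$$ that is, the upper and the lower Gelfand-Kirillov dimensions of $T$ are both equal to $\lambda$. 2. For every finite generating set $X$ of $T$ there are constants $C_1,C_2>0$ such that $C_1m^{\lambda}<\gamma_T(X,m)<C_2m^{\lambda}$ for all integers $m\ge 1$.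 3. $\lambda\in[1,3]$. -/

import Mathlib

open Filter

noncomputable section

namespace Clover

/-! ### Truncated divided power algebras -/

/-- Exponents of the basis monomials `∏ t_a^{(i_a)}`: finitely supported `i` with `i_a < p ^ S_a`. -/
abbrev Expo {Θ : Type*} (p : ℕ) (S : Θ → ℕ) : Type _ := {i : Θ →₀ ℕ // ∀ a, i a < p ^ S a}

/-- The divided power algebra `R(Θ, S)` over `K`: the `K`-vector space on the formal basis
monomials `∏ t_a^{(i_a)}`, `0 ≤ i_a < p ^ S_a`. -/
def DivPow {Θ : Type*} (K : Type*) [Field K] (p : ℕ) (S : Θ → ℕ) : Type _ := Expo p S →₀ K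

namespace DivPow

variable {Θ : Type*} {K : Type*} [Field K] {p : ℕ} {S : Θ → ℕ}

instance : AddCommGroup (DivPow K p S) := inferInstanceAs (AddCommGroup (Expo p S →₀ K))

instance : Module K (DivPow K p S) := inferInstanceAs (Module K (Expo p S →₀ K))

/-- The basis of divided monomials. -/
def basis (K : Type*) [Field K] (p : ℕ) (S : Θ → ℕ) :
    Module.Basis (Expo p S) K (DivPow K p S) := Finsupp.basisSingleOne

open Classical in
/-- The divided monomial with exponents `i`, understood as `0` if some `i_a ≥ p ^ S_a`. -/
def mono (K : Type*) [Field K] (p : ℕ) (S : Θ → ℕ) (i : Θ →₀ ℕ) : DivPow K p S :=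
  if h : ∀ a, i a < p ^ S a then basis K p S ⟨i, h⟩ else 0

/-- `∏_a binom (i_a + j_a) i_a`. -/
def binom (i j : Θ →₀ ℕ) : ℕ := i.prod fun a k => (k + j a).choose k

/-- The product: `t^{(i)} t^{(j)} = ∏_a binom (i_a + j_a) i_a • t^{(i + j)}`. If `i + j` exceeds the
bounds, the coefficient is divisible by the characteristic `p`, so the product is `0`. -/
def mulHom : DivPow K p S →ₗ[K] DivPow K p S →ₗ[K] DivPow K p S :=
  (basis K p S).constr K fun i => (basis K p S).constr K fun j =>
    (binom i.1 j.1 : K) • mono K p S (i.1 + j.1)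

instance : Mul (DivPow K p S) := ⟨fun f g => mulHom f g⟩

instance : One (DivPow K p S) := ⟨mono K p S 0⟩

theorem mul_def (f g : DivPow K p S) : f * g = mulHom f g := rfl

theorem one_def : (1 : DivPow K p S) = mono K p S 0 := rfl

theorem basis_eq_mono (i : Expo p S) : basis K p S i = mono K p S i.1 := by
  simp [mono, i.2]

theorem mono_eq_zero {i : Θ →₀ ℕ} {a : Θ} (h : p ^ S a ≤ i a) : mono K p S i = 0 := by
  rw [mono, dif_neg]
  exact fun h' => absurd (h' a) (not_lt.2 h)

theorem binom_eq_prod {i j : Θ →₀ ℕ} {s : Finset Θ} (h : i.support ⊆ s) :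
    binom i j = ∏ a ∈ s, (i a + j a).choose (i a) :=
  Finsupp.prod_of_support_subset _ h _ (by simp)

theorem mulHom_basis (i j : Expo p S) :
    mulHom (basis K p S i) (basis K p S j) = (binom i.1 j.1 : K) • mono K p S (i.1 + j.1) := by
  simp only [mulHom, Module.Basis.constr_basis]

theorem mono_mul_mono (i j : Θ →₀ ℕ) :
    mono K p S i * mono K p S j = (binom i j : K) • mono K p S (i + j) := by
  by_cases hi : ∀ a, i a < p ^ S a
  · by_cases hj : ∀ a, j a < p ^ S a
    · have h := mulHom_basis (K := K) ⟨i, hi⟩ ⟨j, hj⟩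
      rwa [basis_eq_mono, basis_eq_mono] at h
    · push Not at hj
      obtain ⟨a, ha⟩ := hj
      rw [mono_eq_zero ha, mono_eq_zero (i := i + j) (a := a) (ha.trans (by simp)), mul_def]
      simp
  · push Not at hi
    obtain ⟨a, ha⟩ := hi
    rw [mono_eq_zero ha, mono_eq_zero (i := i + j) (a := a) (ha.trans (by simp)), mul_def]
    simp

theorem smul_mul' (c : K) (f g : DivPow K p S) : (c • f) * g = c • (f * g) := by
  simp [mul_def]

theorem mul_smul' (c : K) (f g : DivPow K p S) : f * (c • g) = c • (f * g) := by
  simp [mul_def]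

theorem binom_comm (i j : Θ →₀ ℕ) : binom i j = binom j i := by
  classical
  rw [binom_eq_prod (s := i.support ∪ j.support) Finset.subset_union_left,
    binom_eq_prod (s := i.support ∪ j.support) Finset.subset_union_right]
  refine Finset.prod_congr rfl fun a _ => ?_
  rw [add_comm (j a), Nat.choose_symm_add]

theorem binom_assoc (i j k : Θ →₀ ℕ) :
    binom i j * binom (i + j) k = binom j k * binom i (j + k) := by
  classical
  have hs : (i + j).support ⊆ i.support ∪ j.support := Finsupp.support_add
  rw [binom_eq_prod (s := i.support ∪ j.support) Finset.subset_union_left,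
    binom_eq_prod (s := i.support ∪ j.support) hs,
    binom_eq_prod (s := i.support ∪ j.support) Finset.subset_union_right,
    binom_eq_prod (s := i.support ∪ j.support) Finset.subset_union_left,
    ← Finset.prod_mul_distrib, ← Finset.prod_mul_distrib]
  refine Finset.prod_congr rfl fun a _ => ?_
  have h := Nat.choose_mul (n := i a + j a + k a) (k := i a + j a) (s := i a)
    (by omega)
  rw [show i a + j a + k a - i a = j a + k a by omega,
    show i a + j a - i a = j a by omega] at h
  simp only [Finsupp.coe_add, Pi.add_apply, ← add_assoc]
  rw [mul_comm, h, mul_comm]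

theorem mul_comm' (f g : DivPow K p S) : f * g = g * f := by
  have h : (mulHom : DivPow K p S →ₗ[K] _) = mulHom.flip := by
    refine (basis K p S).ext fun i => (basis K p S).ext fun j => ?_
    rw [LinearMap.flip_apply, mulHom_basis, mulHom_basis, binom_comm, add_comm]
  rw [mul_def, h, LinearMap.flip_apply, mul_def]

theorem mono_induction {P : DivPow K p S → Prop} (zero : P 0)
    (add : ∀ f g, P f → P g → P (f + g)) (smul : ∀ (c : K) f, P f → P (c • f))
    (mono : ∀ i : Expo p S, P (mono K p S i.1)) (f : DivPow K p S) : P f := by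
  have hf : f ∈ Submodule.span K (Set.range (basis K p S)) := by
    rw [(basis K p S).span_eq]; trivial
  induction hf using Submodule.span_induction with
  | mem g hg => obtain ⟨i, rfl⟩ := hg; rw [basis_eq_mono]; exact mono i
  | zero => exact zero
  | add f g _ _ hf hg => exact add f g hf hg
  | smul c f _ hf => exact smul c f hf

theorem mul_assoc' (f g h : DivPow K p S) : f * g * h = f * (g * h) := by
  have key : ∀ i j k : Θ →₀ ℕ, mono K p S i * mono K p S j * mono K p S k =
      mono K p S i * (mono K p S j * mono K p S k) := by
    intro i j k
    rw [mono_mul_mono, mono_mul_mono, smul_mul', mul_smul', mono_mul_mono, mono_mul_mono,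
      smul_smul, smul_smul, ← Nat.cast_mul, ← Nat.cast_mul, binom_assoc, add_assoc]
  induction f using mono_induction with
  | zero => simp [mul_def]
  | add f₁ f₂ h₁ h₂ => simp only [mul_def, map_add, LinearMap.add_apply] at *; rw [h₁, h₂]
  | smul c f₁ h₁ => rw [smul_mul', smul_mul', smul_mul', h₁]
  | mono i =>
  induction g using mono_induction with
  | zero => simp [mul_def]
  | add f₁ f₂ h₁ h₂ => simp only [mul_def, map_add, LinearMap.add_apply] at *; rw [h₁, h₂]
  | smul c f₁ h₁ => rw [mul_smul', smul_mul', smul_mul', mul_smul', h₁]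
  | mono j =>
  induction h using mono_induction with
  | zero => simp [mul_def]
  | add f₁ f₂ h₁ h₂ => simp only [mul_def, map_add] at *; rw [h₁, h₂]
  | smul c f₁ h₁ => rw [mul_smul', mul_smul', mul_smul', h₁]
  | mono k => exact key i.1 j.1 k.1

theorem one_mul' (f : DivPow K p S) : 1 * f = f := by
  induction f using mono_induction with
  | zero => simp [mul_def]
  | add f₁ f₂ h₁ h₂ => simp only [mul_def, map_add] at *; rw [h₁, h₂]
  | smul c f₁ h₁ => rw [mul_smul', h₁]
  | mono i => rw [one_def, mono_mul_mono]; simp [binom]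

instance : CommRing (DivPow K p S) where
  __ := (inferInstance : AddCommGroup (DivPow K p S))
  left_distrib f g h := by simp [mul_def]
  right_distrib f g h := by simp [mul_def]
  zero_mul f := by simp [mul_def]
  mul_zero f := by simp [mul_def]
  mul_assoc := mul_assoc'
  one_mul := one_mul'
  mul_one f := by rw [mul_comm', one_mul']
  mul_comm := mul_comm'

instance : Algebra K (DivPow K p S) := Algebra.ofModule smul_mul' mul_smul'

/-! ### Derivations -/

/-- `∂_a` as a linear map: it lowers the divided power of `t_a` by one, with `t_a^{(-1)} = 0`. -/
def partialHom (K : Type*) [Field K] (p : ℕ) (S : Θ → ℕ) (a : Θ) :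
    DivPow K p S →ₗ[K] DivPow K p S :=
  (basis K p S).constr K fun i =>
    if i.1 a = 0 then 0 else mono K p S (i.1 - Finsupp.single a 1)

theorem partialHom_mono (a : Θ) {i : Θ →₀ ℕ} (hi : ∀ b, i b < p ^ S b) :
    partialHom K p S a (mono K p S i) =
      if i a = 0 then 0 else mono K p S (i - Finsupp.single a 1) := by
  have h : partialHom K p S a (basis K p S ⟨i, hi⟩) = _ := (basis K p S).constr_basis K _ _
  rwa [basis_eq_mono] at h

theorem binom_pascal {i j : Θ →₀ ℕ} {a : Θ} (hi : i a ≠ 0) (hj : j a ≠ 0) :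
    binom i j = binom (i - Finsupp.single a 1) j + binom i (j - Finsupp.single a 1) := by
  classical
  have h1 : (i - Finsupp.single a 1).support ⊆ i.support := Finsupp.support_tsub
  have ha : a ∈ i.support := Finsupp.mem_support_iff.2 hi
  rw [binom_eq_prod (Finset.Subset.refl i.support), binom_eq_prod h1,
    binom_eq_prod (Finset.Subset.refl i.support), ← Finset.mul_prod_erase _ _ ha,
    ← Finset.mul_prod_erase _ _ ha, ← Finset.mul_prod_erase _ _ ha]
  have e1 : ∀ b ∈ i.support.erase a,
      ((i - Finsupp.single a 1 : Θ →₀ ℕ) b + j b).choose ((i - Finsupp.single a 1 : Θ →₀ ℕ) b) =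
        (i b + j b).choose (i b) := by
    intro b hb
    have hb' : a ≠ b := (Finset.ne_of_mem_erase hb).symm
    simp [hb']
  have e2 : ∀ b ∈ i.support.erase a,
      (i b + (j - Finsupp.single a 1 : Θ →₀ ℕ) b).choose (i b) = (i b + j b).choose (i b) := by
    intro b hb
    have hb' : a ≠ b := (Finset.ne_of_mem_erase hb).symm
    simp [hb']
  rw [Finset.prod_congr rfl e1, Finset.prod_congr rfl e2, ← add_mul]
  congr 1
  simp only [Finsupp.coe_tsub, Pi.sub_apply, Finsupp.single_eq_same]
  obtain ⟨m, hm⟩ := Nat.exists_eq_succ_of_ne_zero hi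
  obtain ⟨n, hn⟩ := Nat.exists_eq_succ_of_ne_zero hj
  rw [hm, hn]
  simp only [Nat.succ_eq_add_one, Nat.add_sub_cancel]
  rw [show m + 1 + (n + 1) = (m + n + 1) + 1 by ring, Nat.choose_succ_succ,
    show m + (n + 1) = m + n + 1 by ring, show m + 1 + n = m + n + 1 by ring]

theorem binom_tsub {i j : Θ →₀ ℕ} {a : Θ} (hi : i a = 0) :
    binom i (j - Finsupp.single a 1) = binom i j := by
  refine Finsupp.prod_congr fun b hb => ?_
  have hb' : a ≠ b := fun h => by simp [← h, hi] at hb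
  simp [hb']

theorem dvd_binom [hp : Fact p.Prime] {i j : Θ →₀ ℕ} {a : Θ} (hi : i a < p ^ S a)
    (hj : j a < p ^ S a) (h : i a + j a = p ^ S a) : p ∣ binom i j := by
  have ha : a ∈ i.support := Finsupp.mem_support_iff.2 fun h0 => by omega
  rw [binom_eq_prod (Finset.Subset.refl i.support)]
  refine dvd_trans ?_ (Finset.dvd_prod_of_mem _ ha)
  rw [h]
  exact hp.out.dvd_choose_pow (by omega) (by omega)

theorem binom_smul_partialHom [Fact p.Prime] [CharP K p] (a : Θ) {i j : Θ →₀ ℕ}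
    (hi : ∀ b, i b < p ^ S b) (hj : ∀ b, j b < p ^ S b) :
    (binom i j : K) • partialHom K p S a (mono K p S (i + j)) =
      if i a + j a = 0 then 0 else (binom i j : K) • mono K p S (i + j - Finsupp.single a 1) := by
  by_cases hij : ∀ b, (i + j) b < p ^ S b
  · rw [partialHom_mono a hij]
    by_cases h0 : i a + j a = 0
    · rw [if_pos h0, if_pos (by simpa using h0), smul_zero]
    · rw [if_neg h0, if_neg (by simpa using h0)]
  · push Not at hij
    obtain ⟨b, hb⟩ := hij
    rw [mono_eq_zero hb, map_zero, smul_zero]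
    split_ifs with h0
    · rfl
    by_cases hb' : p ^ S b ≤ (i + j - Finsupp.single a 1 : Θ →₀ ℕ) b
    · rw [mono_eq_zero hb', smul_zero]
    · have hab : a = b := by
        by_contra hne
        simp [hne] at hb' hb
        omega
      subst hab
      simp only [Finsupp.coe_tsub, Finsupp.coe_add, Pi.sub_apply, Pi.add_apply,
        Finsupp.single_eq_same] at hb hb'
      have hd := dvd_binom (S := S) (hi a) (hj a) (by omega)
      rw [(CharP.cast_eq_zero_iff K p _).2 hd, zero_smul]

theorem partialHom_mono_mul [Fact p.Prime] [CharP K p] (a : Θ) {i j : Θ →₀ ℕ}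
    (hi : ∀ b, i b < p ^ S b) (hj : ∀ b, j b < p ^ S b) :
    partialHom K p S a (mono K p S i * mono K p S j) =
      mono K p S i * partialHom K p S a (mono K p S j) +
        mono K p S j * partialHom K p S a (mono K p S i) := by
  classical
  rw [mono_mul_mono, map_smul, binom_smul_partialHom a hi hj, partialHom_mono a hi,
    partialHom_mono a hj]
  have tsub_add : ∀ k l : Θ →₀ ℕ, k a ≠ 0 →
      l + (k - Finsupp.single a 1) = l + k - Finsupp.single a 1 := by
    intro k l hk
    ext b
    by_cases hb : a = b
    · subst hb; simp; omega
    · simp [hb]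
  by_cases hi0 : i a = 0 <;> by_cases hj0 : j a = 0
  · simp [hi0, hj0]
  · simp only [hi0, hj0, zero_add, if_true, if_false, mul_zero, add_zero]
    rw [mono_mul_mono, binom_tsub hi0, tsub_add _ _ hj0]
  · simp only [hi0, hj0, add_zero, if_true, if_false, mul_zero, zero_add]
    rw [mono_mul_mono, binom_tsub hj0, tsub_add _ _ hi0, add_comm j i, binom_comm i j]
  · rw [if_neg (by omega), if_neg hi0, if_neg hj0, mono_mul_mono, mono_mul_mono,
      tsub_add _ _ hi0, tsub_add _ _ hj0, binom_pascal hi0 hj0, add_comm j i,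
      binom_comm j, Nat.cast_add, add_smul, add_comm]

/-- `∑_{a ∈ Θ} c_a ∂_a` as a linear map. -/
def sumHom (c : Θ → DivPow K p S) : DivPow K p S →ₗ[K] DivPow K p S :=
  (basis K p S).constr K fun i =>
    ∑ a ∈ i.1.support, c a * partialHom K p S a (basis K p S i)

theorem sumHom_mono (c : Θ → DivPow K p S) {i : Θ →₀ ℕ} {s : Finset Θ} (h : i.support ⊆ s) :
    sumHom c (mono K p S i) = ∑ a ∈ s, c a * partialHom K p S a (mono K p S i) := by
  by_cases hi : ∀ b, i b < p ^ S b
  · have h1 : sumHom c (basis K p S ⟨i, hi⟩) = _ := (basis K p S).constr_basis K _ _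
    rw [basis_eq_mono] at h1
    rw [h1]
    refine Finset.sum_subset h fun a _ ha => ?_
    rw [partialHom_mono a hi, if_pos (by simpa using ha), mul_zero]
  · push Not at hi
    obtain ⟨b, hb⟩ := hi
    simp [mono_eq_zero hb]

theorem sumHom_mul [Fact p.Prime] [CharP K p] (c : Θ → DivPow K p S) (f g : DivPow K p S) :
    sumHom c (f * g) = f * sumHom c g + g * sumHom c f := by
  classical
  induction f using mono_induction with
  | zero => simp
  | add f₁ f₂ h₁ h₂ => rw [add_mul, map_add, h₁, h₂, map_add]; ring
  | smul r f₁ h₁ => rw [smul_mul_assoc, map_smul, h₁, map_smul, smul_add, smul_mul_assoc,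
      mul_smul_comm]
  | mono i =>
  induction g using mono_induction with
  | zero => simp
  | add f₁ f₂ h₁ h₂ => rw [mul_add, map_add, h₁, h₂, map_add]; ring
  | smul r f₁ h₁ => rw [mul_smul_comm, map_smul, h₁, map_smul, smul_add, smul_mul_assoc,
      mul_smul_comm]
  | mono j =>
  have hs : (i.1 + j.1).support ⊆ i.1.support ∪ j.1.support := Finsupp.support_add
  rw [sumHom_mono c (i := i.1) (s := i.1.support ∪ j.1.support) Finset.subset_union_left,
    sumHom_mono c (i := j.1) (s := i.1.support ∪ j.1.support) Finset.subset_union_right,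
    mono_mul_mono, map_smul, sumHom_mono c hs, Finset.smul_sum, Finset.mul_sum, Finset.mul_sum,
    ← Finset.sum_add_distrib]
  refine Finset.sum_congr rfl fun a _ => ?_
  have h := partialHom_mono_mul (K := K) (p := p) (S := S) a i.2 j.2
  rw [mono_mul_mono, map_smul] at h
  rw [← mul_smul_comm, h]
  ring

/-- The derivation `∑_{a ∈ Θ} c_a ∂_a` of `R(Θ, S)`, for an arbitrary family `c` of elements of
`R(Θ, S)`. On each element of `R(Θ, S)` only finitely many terms are nonzero, since only finitely
many variables occur in it. -/
def sumDer [Fact p.Prime] [CharP K p] (c : Θ → DivPow K p S) :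
    Derivation K (DivPow K p S) (DivPow K p S) :=
  Derivation.mk' (sumHom c) fun f g => by simp only [smul_eq_mul, sumHom_mul]

/-- The derivation `∂_a` of `R(Θ, S)`: `∂_a (t_a^{(i)}) = t_a^{(i-1)}`, the other variables being
constants. -/
def partialDer [Fact p.Prime] [CharP K p] (a : Θ) :
    Derivation K (DivPow K p S) (DivPow K p S) :=
  Derivation.mk' (partialHom K p S a) fun f g => by
    induction f using mono_induction with
    | zero => simp
    | add f₁ f₂ h₁ h₂ => simp only [add_mul, map_add, h₁, h₂, smul_eq_mul, mul_add]; ring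
    | smul r f₁ h₁ => simp only [smul_mul_assoc, map_smul, h₁, smul_add, smul_eq_mul, mul_smul_comm]
    | mono i =>
    induction g using mono_induction with
    | zero => simp
    | add f₁ f₂ h₁ h₂ => simp only [add_mul, map_add, h₁, h₂, smul_eq_mul, mul_add]; ring
    | smul r f₁ h₁ => simp only [smul_mul_assoc, map_smul, h₁, smul_add, smul_eq_mul, mul_smul_comm]
    | mono j => exact partialHom_mono_mul a i.2 j.2

end DivPow

/-! ### Clover restricted Lie algebras -/

/-- The variables `x_n`, `y_n`, `z_n`, `n ≥ 0`. -/
inductive Var : Type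
  | x (n : ℕ)
  | y (n : ℕ)
  | z (n : ℕ)

/-- The bounds: `x_n` has exponents below `p ^ S_n`; `y_n` and `z_n` have exponents below
`p ^ R_n`. -/
def bound (S R : ℕ → ℕ) : Var → ℕ
  | .x n => S n
  | .y n => R n
  | .z n => R n

/-- The divided power algebra `R(Ξ)` for the tuple `Ξ = (S_n, R_n | n ≥ 0)`. -/
abbrev Alg (K : Type*) [Field K] (p : ℕ) (S R : ℕ → ℕ) : Type _ := DivPow K p (bound S R)

section

variable (K : Type*) [Field K] (p : ℕ) (S R : ℕ → ℕ)

/-- The top divided power of a variable: `a^{(p ^ S_a - 1)}`. -/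
def top (a : Var) : Alg K p S R :=
  DivPow.mono K p (bound S R) (Finsupp.single a (p ^ bound S R a - 1))

variable [Fact p.Prime] [CharP K p]

/-- The pivot element
`v_i = ∂_{x_i} + x_i^{top} y_i^{top} (∂_{x_{i+1}} + x_{i+1}^{top} y_{i+1}^{top} (⋯))`. -/
def v (i : ℕ) : Derivation K (Alg K p S R) (Alg K p S R) :=
  DivPow.sumDer fun
    | .x j => if i ≤ j then ∏ k ∈ Finset.Ico i j, top K p S R (.x k) * top K p S R (.y k) else 0
    | _ => 0

/-- The pivot element
`w_i = ∂_{y_i} + y_i^{top} x_i^{top} (∂_{y_{i+1}} + y_{i+1}^{top} x_{i+1}^{top} (⋯))`. -/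
def w (i : ℕ) : Derivation K (Alg K p S R) (Alg K p S R) :=
  DivPow.sumDer fun
    | .y j => if i ≤ j then ∏ k ∈ Finset.Ico i j, top K p S R (.y k) * top K p S R (.x k) else 0
    | _ => 0

/-- The pivot element
`u_i = ∂_{z_i} + z_i^{top} x_i^{top} (∂_{z_{i+1}} + z_{i+1}^{top} x_{i+1}^{top} (⋯))`. -/
def u (i : ℕ) : Derivation K (Alg K p S R) (Alg K p S R) :=
  DivPow.sumDer fun
    | .z j => if i ≤ j then ∏ k ∈ Finset.Ico i j, top K p S R (.z k) * top K p S R (.x k) else 0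
    | _ => 0

end

namespace DivPow

variable {Θ : Type*} {K : Type*} [Field K] {p : ℕ} {S : Θ → ℕ} [Fact p.Prime] [CharP K p]

theorem sumDer_eq (a : Θ) (q : DivPow K p S) (c d : Θ → DivPow K p S)
    (hc : c a = 1) (hd : d a = 0) (h : ∀ b, b ≠ a → c b = q * d b) :
    sumDer c = partialDer a + q • sumDer d := by
  classical
  ext f
  change sumHom c f = partialHom K p S a f + q * sumHom d f
  induction f using mono_induction with
  | zero => simp
  | add f₁ f₂ h₁ h₂ => rw [map_add, h₁, h₂, map_add, map_add]; ring
  | smul r f₁ h₁ => rw [map_smul, h₁, map_smul, map_smul, smul_add, mul_smul_comm]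
  | mono i =>
  have hs : i.1.support ⊆ insert a i.1.support := Finset.subset_insert _ _
  have ha : a ∈ insert a i.1.support := Finset.mem_insert_self _ _
  rw [sumHom_mono c hs, sumHom_mono d hs, Finset.mul_sum, ← Finset.add_sum_erase _ _ ha,
    ← Finset.add_sum_erase _ _ ha, hc, hd]
  simp only [one_mul, zero_mul, mul_zero, zero_add]
  congr 1
  refine Finset.sum_congr rfl fun b hb => ?_
  rw [h b (Finset.ne_of_mem_erase hb), mul_assoc]

end DivPow

section

variable (K : Type*) [Field K] (p : ℕ) (S R : ℕ → ℕ) [Fact p.Prime] [CharP K p]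

theorem coeff_succ {A : Type*} [CommRing A] (f : ℕ → A) {i j : ℕ} (h : j ≠ i) :
    (if i ≤ j then ∏ k ∈ Finset.Ico i j, f k else 0) =
      f i * if i + 1 ≤ j then ∏ k ∈ Finset.Ico (i + 1) j, f k else 0 := by
  by_cases hij : i ≤ j
  · rw [if_pos hij, if_pos (by omega), Finset.prod_eq_prod_Ico_succ_bot (by omega)]
  · rw [if_neg hij, if_neg (by omega), mul_zero]

/-- The recursive definition of the `v_i`. -/
theorem v_recursion (i : ℕ) :
    v K p S R i = DivPow.partialDer (.x i) +
      (top K p S R (.x i) * top K p S R (.y i)) • v K p S R (i + 1) := by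
  refine DivPow.sumDer_eq _ _ _ _ (by simp) (by simp) fun b hb => ?_
  cases b with
  | x j => exact coeff_succ _ fun h => hb (h ▸ rfl)
  | _ => simp

/-- The recursive definition of the `w_i`. -/
theorem w_recursion (i : ℕ) :
    w K p S R i = DivPow.partialDer (.y i) +
      (top K p S R (.y i) * top K p S R (.x i)) • w K p S R (i + 1) := by
  refine DivPow.sumDer_eq _ _ _ _ (by simp) (by simp) fun b hb => ?_
  cases b with
  | y j => exact coeff_succ _ fun h => hb (h ▸ rfl)
  | _ => simp

/-- The recursive definition of the `u_i`. -/
theorem u_recursion (i : ℕ) :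
    u K p S R i = DivPow.partialDer (.z i) +
      (top K p S R (.z i) * top K p S R (.x i)) • u K p S R (i + 1) := by
  refine DivPow.sumDer_eq _ _ _ _ (by simp) (by simp) fun b hb => ?_
  cases b with
  | z j => exact coeff_succ _ fun h => hb (h ▸ rfl)
  | _ => simp

end

section

variable (K : Type*) [Field K] (p : ℕ) {A : Type*} [Ring A] [Algebra K A]

/-- `Lie_p(X)`: the smallest `K`-subspace of the associative algebra `A` that contains `X` and is
closed under `[a, b] = ab - ba` and under the `p`-mapping `a ↦ a ^ p`. -/
def lieP (X : Set A) : Submodule K A :=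
  sInf {L : Submodule K A | X ⊆ L ∧ (∀ a ∈ L, ∀ b ∈ L, ⁅a, b⁆ ∈ L) ∧ ∀ a ∈ L, a ^ p ∈ L}

/-- Right-normed commutators `[x_1, [x_2, [⋯, x_s]]]`. -/
def rightNormed : List A → A
  | [] => 0
  | [x] => x
  | x :: y :: l => ⁅x, rightNormed (y :: l)⁆

/-- The subspace spanned by all `[x_1, …, x_s] ^ (p ^ k)` with `x_j ∈ X`, `s ≥ 1`, `k ≥ 0` and
`s * p ^ k ≤ n`. -/
def growthSpace (X : Set A) (n : ℕ) : Submodule K A :=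
  Submodule.span K {a | ∃ (l : List A) (k : ℕ), l ≠ [] ∧ (∀ x ∈ l, x ∈ X) ∧
    l.length * p ^ k ≤ n ∧ a = rightNormed l ^ p ^ k}

/-- The growth function of the restricted Lie algebra `Lie_p(X)` with respect to its generating
set `X` (which is meant to be finite, so that the dimensions are finite). -/
def growth (X : Set A) (n : ℕ) : ℕ := Module.finrank K (growthSpace K p X n)

/-- The (upper) Gelfand-Kirillov dimension `limsup ln γ(n) / ln n`. -/
def gkDim (X : Set A) : EReal :=
  limsup (fun n : ℕ => ((Real.log (growth K p X n) / Real.log n : ℝ) : EReal)) atTop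

/-- The lower Gelfand-Kirillov dimension `liminf ln γ(n) / ln n`. -/
def lowerGKDim (X : Set A) : EReal :=
  liminf (fun n : ℕ => ((Real.log (growth K p X n) / Real.log n : ℝ) : EReal)) atTop

end

section

variable (K : Type*) [Field K] (p : ℕ) (S R : ℕ → ℕ) [Fact p.Prime] [CharP K p]

/-- The standard generators `v_0`, `w_0`, `u_0`, as endomorphisms of the space `R(Ξ)`. -/
def gens : Set (Module.End K (Alg K p S R)) :=
  {(v K p S R 0).toLinearMap, (w K p S R 0).toLinearMap, (u K p S R 0).toLinearMap}

/-- The clover restricted Lie algebra `T(Ξ) = Lie_p(v_0, w_0, u_0)`. It is contained in `Der R(Ξ)`,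
whose bracket and `p`-mapping are those of the associative algebra `End R(Ξ)`. -/
def clover : Submodule K (Module.End K (Alg K p S R)) := lieP K p (gens K p S R)

end

end Clover

end

namespace Clover

/-! ### Restricted Lie filtrations: p-powers, Jacobson's formula, change of generating set -/

section RestrictedFiltration

open Polynomial

/-! Give every variable of generation n the weight `scale n` = ∏_{i<n} (p^{S_i} + p^{R_i} - 1). This
is also a degree in which the pivots of generation n are available. There are `boxCard n` =
p^{∑_{i<n} (S_i + 2R_i)} divided monomials in the variables of generation < n, all of weight at most
2 · `scale n`. Up to constant factors, the growth function at m ≈ `scale n` turns out to be `boxCard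
n`. Periodicity makes `scale (kN)` = μ^k and `boxCard (kN)` = p^{σk} = (μ^λ)^k, hence the order m^λ.

Lower bound (`boxCard_le_growth`). A suitable p-power of a pivot is β^{top} times the next pivot
(`IsPivot.pow_eq`), and bracketing with a pivot lowers one divided power by one
(`IsPivot.lie_smul_eq`). Together they produce all pivots in degree `scale n` (`pivots_mem`).
Iterated brackets [v_n, ·] then build the element (all top powers of generation < n) z_n^{top}
u_{n+1} in degree `scale (n+1)` (`full_smul_mem`). Bracketing down from it reaches every monomial of
the box, at a cost equal to the weight removed (`lower_all_mem`); evaluation at z_{n+1} shows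
independence.

Upper bound (`growth_le_boxCard`). Each generator is E + q D_n, where E lowers weights by at most 1
and q has weight `scale n` - 1 (`IsPivot.exists_decomposition`). In a word of length s, a term with
two factors D_n has a coefficient that raises weights by at least 2 · `scale n` - s. If this exceeds
the largest weight, the term vanishes, so short words are affine in the pivots of generation n
(`pow_span_le_affineSpace`). Such an operator is determined by its values on generations ≤ n
(`affineSpace_eq_zero`). A derivation is determined there by its values on the t^{(p^k)}
(`derSubmodule_eq_zero`), and triangularity puts these values in small boxes; the box dimensions add
up geometrically.

The growth spaces form the smallest filtration, compatible with brackets and p-th powers, that has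
the generators in degree 1. This gives the linear equivalence of the growth functions of different
finite generating sets (`exists_growthSpace_le`). -/

theorem cast_choose_sub_one (A : Type*) [Ring A] (p : ℕ) [Fact p.Prime] [CharP A p] (k : ℕ) {i : ℕ}
    (hi : i < p ^ k) : (((p ^ k - 1).choose i : ℕ) : A) = (-1) ^ i := by
  have hp : p.Prime := Fact.out
  induction i with
  | zero => simp
  | succ i ih =>
    -- Neighbours in row p^k - 1 of Pascal's triangle add up to an inner entry of row p^k, which is
    -- 0 in characteristic p.
    have h := Nat.choose_succ_succ (p ^ k - 1) i
    rw [Nat.succ_eq_add_one, Nat.sub_add_cancel (Nat.one_le_pow _ _ hp.pos)] at h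
    have hd : p ∣ (p ^ k).choose (i + 1) := hp.dvd_choose_pow (by omega) (by omega)
    have h2 := (CharP.cast_eq_zero_iff A p _).2 hd
    rw [h, Nat.cast_add, ih (by omega)] at h2
    rw [pow_succ, mul_neg_one, eq_neg_iff_add_eq_zero, add_comm]
    exact h2

variable {K : Type*} [Field K] {A : Type*} [Ring A] [Algebra K A]

theorem charP_end (K : Type*) [Field K] (A : Type*) [AddCommGroup A] [Module K A] [Nontrivial A]
    (p : ℕ) [CharP K p] : CharP (Module.End K A) p :=
  charP_of_injective_algebraMap (algebraMap K (Module.End K A)).injective p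

theorem ring_add_lie (a b c : A) : ⁅a + b, c⁆ = ⁅a, c⁆ + ⁅b, c⁆ := by
  simp only [Ring.lie_def, add_mul, mul_add]; abel

theorem ring_lie_add (a b c : A) : ⁅a, b + c⁆ = ⁅a, b⁆ + ⁅a, c⁆ := by
  simp only [Ring.lie_def, add_mul, mul_add]; abel

theorem ring_smul_lie (r : K) (a b : A) : ⁅r • a, b⁆ = r • ⁅a, b⁆ := by
  simp [Ring.lie_def, smul_sub]

theorem ring_lie_smul (r : K) (a b : A) : ⁅a, r • b⁆ = r • ⁅a, b⁆ := by
  simp [Ring.lie_def, smul_sub]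

theorem ring_zero_lie (a : A) : ⁅(0 : A), a⁆ = 0 := by simp [Ring.lie_def]

theorem ring_lie_zero (a : A) : ⁅a, (0 : A)⁆ = 0 := by simp [Ring.lie_def]

theorem ring_lie_lie (a b c : A) : ⁅⁅a, b⁆, c⁆ = ⁅a, ⁅b, c⁆⁆ - ⁅b, ⁅a, c⁆⁆ := by
  simp only [Ring.lie_def]; noncomm_ring

theorem ring_neg_lie_swap (a b : A) : -⁅b, a⁆ = ⁅a, b⁆ := by simp [Ring.lie_def]

/-- The map `b ↦ [a, b]`. -/
def adHom (K : Type*) [Field K] {A : Type*} [Ring A] [Algebra K A] (a : A) : Module.End K A :=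
  LinearMap.mulLeft K a - LinearMap.mulRight K a

theorem adHom_apply (a b : A) : adHom K a b = ⁅a, b⁆ := rfl

/-- In characteristic `p`, `[a ^ (p ^ k), b] = ad(a) ^ (p ^ k) b`. -/
theorem lie_pow_char_pow (p : ℕ) [Fact p.Prime] [CharP K p] (a b : A) (k : ℕ) :
    ⁅a ^ p ^ k, b⁆ = (adHom K a ^ p ^ k) b := by
  cases subsingleton_or_nontrivial A
  · exact Subsingleton.elim _ _
  have := charP_end K A p
  rw [adHom,
    sub_pow_char_pow_of_commute _ _ (LinearMap.commute_mulLeft_right a a), LinearMap.pow_mulLeft,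
    LinearMap.pow_mulRight]
  simp [Ring.lie_def]

/-- In characteristic `p`, `∑ a ^ i b a ^ (p ^ k - 1 - i) = ad(a) ^ (p ^ k - 1) b`. -/
theorem sum_pow_mul_mul_pow (p : ℕ) [Fact p.Prime] [CharP K p] (a b : A) (k : ℕ) :
    ∑ i ∈ Finset.range (p ^ k), a ^ i * b * a ^ (p ^ k - 1 - i) =
      (adHom K a ^ (p ^ k - 1)) b := by
  cases subsingleton_or_nontrivial A
  · exact Subsingleton.elim _ _
  have := charP_end K A p
  have hp : p.Prime := Fact.out
  have hpos : 1 ≤ p ^ k := Nat.one_le_pow _ _ hp.pos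
  -- Expand ad(a) = -R + L for the commuting right and left multiplications R and L by a: the
  -- binomial coefficient (-1)^i cancels the sign of (-R)^i.
  have hc : Commute (-LinearMap.mulRight K a) (LinearMap.mulLeft K a) :=
    Commute.neg_left (R := Module.End K A) (LinearMap.commute_mulLeft_right a a).symm
  rw [adHom, sub_eq_neg_add, hc.add_pow, Nat.sub_add_cancel hpos,
    LinearMap.sum_apply, ← Finset.sum_range_reflect]
  refine Finset.sum_congr rfl fun i hi => ?_
  have hi' : i < p ^ k := Finset.mem_range.1 hi
  rw [cast_choose_sub_one _ p k hi', neg_pow (R := Module.End K A) (LinearMap.mulRight K a), LinearMap.pow_mulLeft, LinearMap.pow_mulRight,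
    show p ^ k - 1 - (p ^ k - 1 - i) = i by omega]
  rcases neg_one_pow_eq_or (Module.End K A) i with h | h <;> rw [h] <;> simp [mul_assoc]

theorem derivative_pow_eq_sum (P : A[X]) (n : ℕ) :
    derivative (P ^ n) = ∑ i ∈ Finset.range n, P ^ i * derivative P * P ^ (n - 1 - i) := by
  induction n with
  | zero => simp
  | succ n ih =>
    rw [pow_succ, derivative_mul, ih, Finset.sum_range_succ, Finset.sum_mul]
    congr 1
    · refine Finset.sum_congr rfl fun i hi => ?_
      have := Finset.mem_range.1 hi
      rw [mul_assoc, ← pow_succ, show n - 1 - i + 1 = n + 1 - 1 - i by omega]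
    · simp

/-- An increasing filtration of a subspace by subspaces that is compatible with the bracket and
with the `p`-mapping. -/
structure IsRestrictedFiltration (p : ℕ) (F : ℕ → Submodule K A) : Prop where
  mono : Monotone F
  lie_mem : ∀ {m n a b}, a ∈ F m → b ∈ F n → ⁅a, b⁆ ∈ F (m + n)
  pow_mem : ∀ {m a}, a ∈ F m → a ^ p ∈ F (m * p)

/-- Each coefficient is a combination of commutators of a and b with n + 1 entries: coefficient i +
1 of [aX + b, Q] is [a, Q_i] + [b, Q_{i+1}]. -/
theorem coeff_ad_pow_mem {F : ℕ → Submodule K A}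
    (hF : ∀ {m n a b}, a ∈ F m → b ∈ F n → ⁅a, b⁆ ∈ F (m + n)) {m : ℕ} {a b : A}
    (ha : a ∈ F m) (hb : b ∈ F m) (n i : ℕ) :
    ((adHom K (C a * X + C b) ^ n) (C a)).coeff i ∈ F (m * (n + 1)) := by
  induction n generalizing i with
  | zero =>
    rw [pow_zero, Module.End.one_apply, coeff_C]
    split_ifs
    · simpa using ha
    · exact zero_mem _
  | succ n ih =>
    rw [pow_succ', Module.End.mul_apply, adHom_apply]
    set Q := (adHom K (C a * X + C b) ^ n) (C a)
    have e : ∀ c : A, c ∈ F m → ∀ j, c * Q.coeff j - Q.coeff j * c ∈ F (m * (n + 1 + 1)) := by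
      intro c hc j
      have := hF hc (ih j)
      rwa [Ring.lie_def, show m + m * (n + 1) = m * (n + 1 + 1) by ring] at this
    rw [Ring.lie_def, add_mul, mul_add (Q), mul_assoc (C a), X_mul, ← mul_assoc, ← mul_assoc]
    cases i with
    | zero => simpa using e b hb 0
    | succ i =>
      simp only [coeff_sub, coeff_add, coeff_mul_X, coeff_C_mul, coeff_mul_C]
      have := add_mem (e a ha i) (e b hb (i + 1))
      convert this using 1
      abel

/-- Jacobson's formula, in the form: `(a + b) ^ p - a ^ p - b ^ p` is a Lie polynomial of degree
`p` in `a` and `b`. -/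
theorem add_pow_sub_pow_sub_pow_mem (p : ℕ) [Fact p.Prime] [CharP K p] {F : ℕ → Submodule K A}
    (hF : ∀ {m n a b}, a ∈ F m → b ∈ F n → ⁅a, b⁆ ∈ F (m + n)) {m : ℕ} {a b : A}
    (ha : a ∈ F m) (hb : b ∈ F m) : (a + b) ^ p - a ^ p - b ^ p ∈ F (m * p) := by
  have hp : p.Prime := Fact.out
  set P : A[X] := C a * X + C b with hP
  -- With P = aX + b the value P^p at X = 1 is (a + b)^p, and its extreme coefficients are a^p and
  -- b^p. The derivative exposes the other coefficients as Lie polynomials.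
  have hd : derivative (P ^ p) = (adHom K P ^ (p - 1)) (C a) := by
    have h := sum_pow_mul_mul_pow (K := K) p P (C a) 1
    rw [pow_one] at h
    rw [derivative_pow_eq_sum, ← h]
    simp [hP]
  have hdeg : P.natDegree ≤ 1 := natDegree_linear_le
  have hdegp : (P ^ p).natDegree < p + 1 :=
    Nat.lt_succ_of_le ((natDegree_pow_le_of_le p hdeg).trans (by simp))
  have hev : (a + b) ^ p = ∑ i ∈ Finset.range (p + 1), (P ^ p).coeff i := by
    let φ : A[X] →+* A := eval₂RingHom' (RingHom.id A) 1 fun a => Commute.one_right _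
    have h1 : φ P = a + b := by simp [φ, P]
    rw [← h1, ← map_pow]
    change eval₂ _ _ _ = _
    rw [eval₂_eq_sum_range' _ hdegp]
    simp
  have htop : (P ^ p).coeff p = a ^ p := by
    have h := coeff_pow_of_natDegree_le (m := p) hdeg
    rw [mul_one] at h
    rw [h]; simp [hP]
  have hbot : (P ^ p).coeff 0 = b ^ p := by
    change constantCoeff (P ^ p) = _
    rw [map_pow]
    simp [hP]
  rw [hev, Finset.sum_range_succ, htop, Finset.sum_range_eq_add_Ico _ hp.pos, hbot,
    show ∀ x y z : A, x + y + z - z - x = y by intros; abel]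
  refine sum_mem fun i hi => ?_
  obtain ⟨hi1, hi2⟩ := Finset.mem_Ico.1 hi
  obtain ⟨j, rfl⟩ : ∃ j, i = j + 1 := ⟨i - 1, by omega⟩
  have hc := coeff_ad_pow_mem (K := K) hF ha hb (p - 1) j
  rw [Nat.sub_add_cancel hp.pos, ← hP, ← hd, coeff_derivative] at hc
  -- Differentiation multiplied the middle coefficient by j + 1, which is invertible because 0 < j +
  -- 1 < p.
  have hne : ((j + 1 : ℕ) : K) ≠ 0 := by
    rw [Ne, CharP.cast_eq_zero_iff K p]
    exact fun h => absurd (Nat.le_of_dvd (by omega) h) (by omega)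
  have h2 := (F (m * p)).smul_mem (((j + 1 : ℕ) : K)⁻¹) hc
  have h3 : (P ^ p).coeff (j + 1) * ((j : A) + 1) = ((j + 1 : ℕ) : K) • (P ^ p).coeff (j + 1) := by
    rw [Algebra.smul_def, map_natCast, ← Nat.cast_add_one, Nat.cast_comm]
  rwa [h3, smul_smul, inv_mul_cancel₀ hne, one_smul] at h2

/-- Spans of right-normed commutators of bounded length. -/
def lieSpace (K : Type*) [Field K] {A : Type*} [Ring A] [Algebra K A] (X : Set A) (n : ℕ) :
    Submodule K A :=
  Submodule.span K {a | ∃ l : List A, l ≠ [] ∧ (∀ x ∈ l, x ∈ X) ∧ l.length ≤ n ∧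
    a = rightNormed l}

theorem lieSpace_mono (X : Set A) : Monotone (lieSpace K X) := fun _ _ h =>
  Submodule.span_mono fun _ ⟨l, h1, h2, h3, h4⟩ => ⟨l, h1, h2, h3.trans h, h4⟩

theorem lie_mem_lieSpace_succ {X : Set A} {x b : A} (hx : x ∈ X) {n : ℕ}
    (hb : b ∈ lieSpace K X n) : ⁅x, b⁆ ∈ lieSpace K X (n + 1) := by
  induction hb using Submodule.span_induction with
  | mem b hb =>
    obtain ⟨l, h1, h2, h3, rfl⟩ := hb
    obtain ⟨y, l, rfl⟩ := List.exists_cons_of_ne_nil h1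
    refine Submodule.subset_span ⟨x :: y :: l, by simp, ?_, by simpa using h3, rfl⟩
    intro z hz
    rcases List.mem_cons.1 hz with rfl | hz
    exacts [hx, h2 z hz]
  | zero => simp [ring_lie_zero]
  | add b c _ _ hb hc => rw [ring_lie_add]; exact add_mem hb hc
  | smul r b _ hb => rw [ring_lie_smul]; exact Submodule.smul_mem _ _ hb

/-- By the Jacobi identity, [[x, c], b] = [x, [c, b]] - [c, [x, b]]; induction on the left entry
rewrites everything in right-normed form. -/
theorem lie_rightNormed_mem {X : Set A} (l : List A) (hl : ∀ x ∈ l, x ∈ X) {n : ℕ} {b : A}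
    (hb : b ∈ lieSpace K X n) : ⁅rightNormed l, b⁆ ∈ lieSpace K X (l.length + n) := by
  induction l generalizing n b with
  | nil => simp [rightNormed, ring_zero_lie]
  | cons x l ih =>
    have hx : x ∈ X := hl x (by simp)
    have hl' : ∀ y ∈ l, y ∈ X := fun y hy => hl y (by simp [hy])
    cases l with
    | nil =>
      simp only [rightNormed, List.length_cons, List.length_nil, zero_add]
      rw [add_comm]
      exact lie_mem_lieSpace_succ hx hb
    | cons y l =>
      rw [rightNormed, ring_lie_lie]
      refine sub_mem ?_ ?_
      · have := lie_mem_lieSpace_succ hx (ih hl' hb)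
        rwa [List.length_cons, add_right_comm]
      · have := ih hl' (lie_mem_lieSpace_succ hx hb)
        rwa [List.length_cons, add_right_comm, add_assoc]

theorem lie_mem_lieSpace {X : Set A} {m n : ℕ} {a b : A} (ha : a ∈ lieSpace K X m)
    (hb : b ∈ lieSpace K X n) : ⁅a, b⁆ ∈ lieSpace K X (m + n) := by
  induction ha using Submodule.span_induction with
  | mem a ha =>
    obtain ⟨l, h1, h2, h3, rfl⟩ := ha
    exact lieSpace_mono X (by omega) (lie_rightNormed_mem l h2 hb)
  | zero => simp [ring_zero_lie]
  | add b c _ _ hb hc => rw [ring_add_lie]; exact add_mem hb hc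
  | smul r b _ hb => rw [ring_smul_lie]; exact Submodule.smul_mem _ _ hb

theorem ad_pow_mem {F : ℕ → Submodule K A}
    (hF : ∀ {m n a b}, a ∈ F m → b ∈ F n → ⁅a, b⁆ ∈ F (m + n)) {m n : ℕ} {a b : A}
    (ha : a ∈ F m) (hb : b ∈ F n) (k : ℕ) :
    (adHom K a ^ k) b ∈ F (m * k + n) := by
  induction k with
  | zero => simpa using hb
  | succ k ih =>
    rw [pow_succ', Module.End.mul_apply, adHom_apply]
    have := hF ha ih
    rwa [show m * (k + 1) + n = m + (m * k + n) by ring]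

section

variable (p : ℕ)

theorem lieSpace_le_growthSpace (X : Set A) (n : ℕ) : lieSpace K X n ≤ growthSpace K p X n :=
  Submodule.span_mono fun _ ⟨l, h1, h2, h3, h4⟩ => ⟨l, 0, h1, h2, by simpa using h3, by simpa using h4⟩

theorem growthSpace_mono (X : Set A) : Monotone (growthSpace K p X) := fun _ _ h =>
  Submodule.span_mono fun _ ⟨l, k, h1, h2, h3, h4⟩ => ⟨l, k, h1, h2, h3.trans h, h4⟩

end

section

variable {p : ℕ}

theorem IsRestrictedFiltration.rightNormed_mem {F : ℕ → Submodule K A}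
    (hF : IsRestrictedFiltration p F) {X : Set A} (hX : X ⊆ F 1) (l : List A)
    (hl : ∀ x ∈ l, x ∈ X) : rightNormed l ∈ F l.length := by
  induction l with
  | nil => exact zero_mem _
  | cons x l ih =>
    have hx := hX (hl x (by simp))
    have hl' := ih fun y hy => hl y (by simp [hy])
    cases l with
    | nil => exact hx
    | cons y l =>
      have := hF.lie_mem hx hl'
      rwa [add_comm] at this

theorem IsRestrictedFiltration.pow_pow_mem {F : ℕ → Submodule K A}
    (hF : IsRestrictedFiltration p F) {m : ℕ} {a : A} (ha : a ∈ F m) (k : ℕ) :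
    a ^ p ^ k ∈ F (m * p ^ k) := by
  induction k with
  | zero => simpa using ha
  | succ k ih =>
    rw [pow_succ, pow_mul, ← mul_assoc]
    exact hF.pow_mem ih

/-- Minimality of the growth filtration. Every containment of growth spaces below comes from
choosing a suitable filtration: a rescaled growth filtration, a constant one, or the zero one. -/
theorem IsRestrictedFiltration.growthSpace_le {F : ℕ → Submodule K A}
    (hF : IsRestrictedFiltration p F) {X : Set A} (hX : X ⊆ F 1) (n : ℕ) :
    growthSpace K p X n ≤ F n := by
  refine Submodule.span_le.2 ?_
  rintro _ ⟨l, k, h1, h2, h3, rfl⟩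
  exact hF.mono h3 (hF.pow_pow_mem (hF.rightNormed_mem hX l h2) k)

theorem subset_growthSpace_one (X : Set A) : X ⊆ growthSpace K p X 1 := fun x hx =>
  Submodule.subset_span ⟨[x], 0, by simp, by simpa using hx, by simp, by simp [rightNormed]⟩

theorem subset_lieP (X : Set A) : X ⊆ lieP K p X := fun _ hx =>
  Submodule.mem_sInf.2 fun _ hL => hL.1 hx

end

variable (p : ℕ) [Fact p.Prime]

theorem finiteDimensional_growthSpace {X : Set A} (hX : X.Finite) (n : ℕ) :
    FiniteDimensional K (growthSpace K p X n) := by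
  have hp : p.Prime := Fact.out
  have := hX.to_subtype
  refine FiniteDimensional.span_of_finite K (Set.Finite.subset
    (Set.Finite.image2 (fun (l : List X) (k : ℕ) => rightNormed (l.map Subtype.val) ^ p ^ k)
      (List.finite_length_le X n) (Set.finite_Iic n)) ?_)
  rintro _ ⟨l, k, h1, h2, h3, rfl⟩
  have hl : 1 ≤ l.length := List.length_pos_iff.2 h1
  lift l to List X using h2
  rw [List.length_map] at h3 hl
  refine ⟨l, ?_, k, ?_, rfl⟩
  · exact (Nat.le_mul_of_pos_right _ (Nat.pow_pos hp.pos)).trans h3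
  · exact ((Nat.lt_pow_self hp.one_lt).le.trans (Nat.le_mul_of_pos_left _ hl)).trans h3

variable [CharP K p]

/-- Since ad(a^{p^k}) = ad(a)^{p^k}, a bracket of p-powers is an ordinary iterated commutator with
the same number of letters; no p-powers remain. -/
theorem lie_pow_pow_mem {F : ℕ → Submodule K A}
    (hF : ∀ {m n a b}, a ∈ F m → b ∈ F n → ⁅a, b⁆ ∈ F (m + n)) {s t : ℕ} {a b : A}
    (ha : a ∈ F s) (hb : b ∈ F t) (k l : ℕ) :
    ⁅a ^ p ^ k, b ^ p ^ l⁆ ∈ F (s * p ^ k + t * p ^ l) := by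
  have hp : p.Prime := Fact.out
  have hpos : 1 ≤ p ^ k := Nat.one_le_pow _ _ hp.pos
  obtain ⟨q, hq⟩ : ∃ q, p ^ k = q + 1 := ⟨p ^ k - 1, by omega⟩
  have h1 : ⁅a, b ^ p ^ l⁆ ∈ F (t * p ^ l + s) := by
    rw [← ring_neg_lie_swap, lie_pow_char_pow (K := K) p]
    exact neg_mem (ad_pow_mem hF hb ha _)
  rw [lie_pow_char_pow (K := K) p, hq, pow_succ, Module.End.mul_apply, adHom_apply,
    show s * (q + 1) + t * p ^ l = s * q + (t * p ^ l + s) by ring]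
  exact ad_pow_mem hF ha h1 q

theorem rightNormed_mem_lieSpace {X : Set A} {l : List A} (h : l ≠ []) (hl : ∀ x ∈ l, x ∈ X) :
    rightNormed l ∈ lieSpace K X l.length :=
  Submodule.subset_span ⟨l, h, hl, le_rfl, rfl⟩

theorem lie_mem_growthSpace {X : Set A} {m n : ℕ} {a b : A} (ha : a ∈ growthSpace K p X m)
    (hb : b ∈ growthSpace K p X n) : ⁅a, b⁆ ∈ growthSpace K p X (m + n) := by
  induction ha using Submodule.span_induction with
  | zero => simp [ring_zero_lie]
  | add b c _ _ hb hc => rw [ring_add_lie]; exact add_mem hb hc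
  | smul r b _ hb => rw [ring_smul_lie]; exact Submodule.smul_mem _ _ hb
  | mem a ha =>
  obtain ⟨l, k, h1, h2, h3, rfl⟩ := ha
  induction hb using Submodule.span_induction with
  | zero => simp [ring_lie_zero]
  | add b c _ _ hb hc => rw [ring_lie_add]; exact add_mem hb hc
  | smul r b _ hb => rw [ring_lie_smul]; exact Submodule.smul_mem _ _ hb
  | mem b hb =>
  obtain ⟨l', k', h1', h2', h3', rfl⟩ := hb
  exact lieSpace_le_growthSpace p X _ (lieSpace_mono X (add_le_add h3 h3')
    (lie_pow_pow_mem p (F := lieSpace K X) lie_mem_lieSpace (rightNormed_mem_lieSpace h1 h2)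
      (rightNormed_mem_lieSpace h1' h2') k k'))

/-- For the p-mapping only sums need care: by Jacobson's formula (b + c)^p differs from b^p + c^p by
a Lie polynomial, which closure under brackets already covers. -/
theorem isRestrictedFiltration_growthSpace (X : Set A) :
    IsRestrictedFiltration p (growthSpace K p X) where
  mono := growthSpace_mono p X
  lie_mem := lie_mem_growthSpace p
  pow_mem {m a} ha := by
    have hp : p.Prime := Fact.out
    have ha' : a ∈ growthSpace K p X m ∧ a ^ p ∈ growthSpace K p X (m * p) := by
      induction ha using Submodule.span_induction with
      | mem a ha =>
        refine ⟨Submodule.subset_span ha, ?_⟩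
        obtain ⟨l, k, h1, h2, h3, rfl⟩ := ha
        refine Submodule.subset_span ⟨l, k + 1, h1, h2, ?_, by rw [← pow_mul, pow_succ]⟩
        rw [pow_succ, ← mul_assoc]
        exact Nat.mul_le_mul_right _ h3
      | zero => simp [hp.ne_zero]
      | add b c _ _ hb hc =>
        refine ⟨add_mem hb.1 hc.1, ?_⟩
        have := add_mem (add_mem (add_pow_sub_pow_sub_pow_mem p (F := growthSpace K p X)
          (lie_mem_growthSpace p) hb.1 hc.1)
          hb.2) hc.2
        convert this using 1
        abel
      | smul r b _ hb =>
        refine ⟨Submodule.smul_mem _ _ hb.1, ?_⟩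
        rw [_root_.smul_pow]
        exact Submodule.smul_mem _ _ hb.2
    exact ha'.2

variable {p}

theorem exists_mem_growthSpace_of_mem_lieP {X : Set A} {a : A} (ha : a ∈ lieP K p X) :
    ∃ n, a ∈ growthSpace K p X n := by
  have hF := isRestrictedFiltration_growthSpace (K := K) p X
  let L : Submodule K A :=
    { carrier := {a | ∃ n, a ∈ growthSpace K p X n}
      zero_mem' := ⟨0, zero_mem _⟩
      add_mem' := fun ⟨m, hm⟩ ⟨n, hn⟩ => ⟨max m n,
        add_mem (hF.mono (le_max_left _ _) hm) (hF.mono (le_max_right _ _) hn)⟩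
      smul_mem' := fun c _ ⟨n, hn⟩ => ⟨n, Submodule.smul_mem _ _ hn⟩ }
  have hL : lieP K p X ≤ L := sInf_le ⟨fun x hx => ⟨1, subset_growthSpace_one X hx⟩,
    fun a ⟨m, hm⟩ b ⟨n, hn⟩ => ⟨m + n, hF.lie_mem hm hn⟩, fun a ⟨m, hm⟩ => ⟨m * p, hF.pow_mem hm⟩⟩
  exact hL ha

/-- Growth filtrations with respect to finite generating sets are linearly equivalent. -/
theorem exists_growthSpace_le {X Y : Set A} (hX : X.Finite) (h : lieP K p X ≤ lieP K p Y) :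
    ∃ c, 1 ≤ c ∧ ∀ n, growthSpace K p X n ≤ growthSpace K p Y (c * n) := by
  have hY := isRestrictedFiltration_growthSpace (K := K) p Y
  have h1 : ∀ x ∈ X, ∃ n, x ∈ growthSpace K p Y n := fun x hx =>
    exists_mem_growthSpace_of_mem_lieP (h (subset_lieP X hx))
  choose! f hf using h1
  obtain ⟨c, hc⟩ := (hX.image f).bddAbove
  refine ⟨c + 1, by omega, fun n => ?_⟩
  -- The bracket and the p-mapping scale degrees linearly, so stretching the degrees by a constant
  -- gives a filtration again; the constant is chosen so that X lies in degree 1.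
  have hF : IsRestrictedFiltration p fun n => growthSpace K p Y ((c + 1) * n) :=
    { mono := fun a b hab => hY.mono (Nat.mul_le_mul_left _ hab)
      lie_mem := fun {m n a b} ha hb => by rw [mul_add]; exact hY.lie_mem ha hb
      pow_mem := fun {m a} ha => by rw [← mul_assoc]; exact hY.pow_mem ha }
  refine hF.growthSpace_le (fun x hx => ?_) n
  refine hY.mono ?_ (hf x hx)
  have := hc (Set.mem_image_of_mem f hx)
  omega

end RestrictedFiltration

end Clover

/-! ### Divided powers in a subset of the variables -/

noncomputable section

namespace Clover

namespace DivPow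

variable {Θ : Type*} {K : Type*} [Field K] {p : ℕ} {S : Θ → ℕ}

theorem mono_mul_mono_of_disjoint {i j : Θ →₀ ℕ} (h : ∀ a, i a = 0 ∨ j a = 0) :
    mono K p S i * mono K p S j = mono K p S (i + j) := by
  have : binom i j = 1 := Finset.prod_eq_one fun a ha => by
    rcases h a with h | h
    · exact absurd h (Finsupp.mem_support_iff.1 ha)
    · simp [h]
  rw [mono_mul_mono, this, Nat.cast_one, one_smul]

/-- The span of the divided monomials in the variables of `s`. -/
def subspace (K : Type*) [Field K] (p : ℕ) (S : Θ → ℕ) (s : Set Θ) : Submodule K (DivPow K p S) :=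
  Submodule.span K {f | ∃ i : Expo p S, (∀ a, i.1 a ≠ 0 → a ∈ s) ∧ f = mono K p S i.1}

theorem mono_mem_subspace {s : Set Θ} {i : Θ →₀ ℕ} (h : ∀ a, i a ≠ 0 → a ∈ s) :
    mono K p S i ∈ subspace K p S s := by
  by_cases hi : ∀ a, i a < p ^ S a
  · exact Submodule.subset_span ⟨⟨i, hi⟩, h, rfl⟩
  · rw [mono, dif_neg hi]
    exact zero_mem _

theorem one_mem_subspace (s : Set Θ) : (1 : DivPow K p S) ∈ subspace K p S s :=
  mono_mem_subspace fun _ h => absurd rfl h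

theorem subspace_mono {s t : Set Θ} (h : s ⊆ t) : subspace K p S s ≤ subspace K p S t :=
  Submodule.span_mono fun _ ⟨i, h1, h2⟩ => ⟨i, fun a ha => h (h1 a ha), h2⟩

theorem subspace_induction {s : Set Θ} {P : (f : DivPow K p S) → f ∈ subspace K p S s → Prop}
    (zero : P 0 (zero_mem _))
    (add : ∀ f g hf hg, P f hf → P g hg → P (f + g) (add_mem hf hg))
    (smul : ∀ (c : K) f hf, P f hf → P (c • f) (Submodule.smul_mem _ c hf))
    (mono : ∀ (i : Expo p S) (h : ∀ a, i.1 a ≠ 0 → a ∈ s),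
      P (mono K p S i.1) (mono_mem_subspace h)) {f : DivPow K p S}
    (hf : f ∈ subspace K p S s) : P f hf := by
  induction hf using Submodule.span_induction with
  | mem f hf => obtain ⟨i, h, rfl⟩ := hf; exact mono i h
  | zero => exact zero
  | add f g _ _ hf hg => exact add f g _ _ hf hg
  | smul c f _ hf => exact smul c f _ hf

theorem mul_mem_subspace {s : Set Θ} {f g : DivPow K p S} (hf : f ∈ subspace K p S s)
    (hg : g ∈ subspace K p S s) : f * g ∈ subspace K p S s := by
  induction hf using subspace_induction with
  | zero => simp
  | add f₁ f₂ _ _ h₁ h₂ => rw [add_mul]; exact add_mem h₁ h₂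
  | smul c f _ h => rw [smul_mul_assoc]; exact Submodule.smul_mem _ _ h
  | mono i hi =>
  induction hg using subspace_induction with
  | zero => simp
  | add f₁ f₂ _ _ h₁ h₂ => rw [mul_add]; exact add_mem h₁ h₂
  | smul c f _ h => rw [mul_smul_comm]; exact Submodule.smul_mem _ _ h
  | mono j hj =>
  rw [mono_mul_mono]
  refine Submodule.smul_mem _ _ (mono_mem_subspace fun a ha => ?_)
  by_cases h : i.1 a = 0
  · exact hj a fun h' => ha (by simp [h, h'])
  · exact hi a h

theorem exists_mem_subspace_finset (f : DivPow K p S) :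
    ∃ s : Finset Θ, f ∈ subspace K p S (s : Set Θ) := by
  classical
  induction f using mono_induction with
  | zero => exact ⟨∅, zero_mem _⟩
  | add f g hf hg =>
    obtain ⟨s, hs⟩ := hf
    obtain ⟨t, ht⟩ := hg
    exact ⟨s ∪ t, add_mem (subspace_mono (by simp) hs) (subspace_mono (by simp) ht)⟩
  | smul c f hf => obtain ⟨s, hs⟩ := hf; exact ⟨s, Submodule.smul_mem _ _ hs⟩
  | mono i => exact ⟨i.1.support, mono_mem_subspace fun a ha => by simpa using ha⟩

variable [Fact p.Prime] [CharP K p]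

theorem partialDer_mono (a : Θ) {i : Θ →₀ ℕ} (hi : ∀ b, i b < p ^ S b) :
    partialDer a (mono K p S i) = if i a = 0 then 0 else mono K p S (i - Finsupp.single a 1) :=
  partialHom_mono a hi

theorem partialDer_mono_add {a : Θ} {i : Θ →₀ ℕ}
    (hi : ∀ b, (i + Finsupp.single a 1 : Θ →₀ ℕ) b < p ^ S b) :
    partialDer a (mono K p S (i + Finsupp.single a 1)) = mono K p S i := by
  rw [partialDer_mono a hi, if_neg (by simp), add_tsub_cancel_right]

theorem partialDer_mem_subspace (a : Θ) {s : Set Θ} {f : DivPow K p S}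
    (hf : f ∈ subspace K p S s) : partialDer a f ∈ subspace K p S s := by
  induction hf using subspace_induction with
  | zero => simp
  | add f₁ f₂ _ _ h₁ h₂ => rw [map_add]; exact add_mem h₁ h₂
  | smul c f _ h => rw [Derivation.map_smul]; exact Submodule.smul_mem _ _ h
  | mono i hi =>
    rw [partialDer_mono a i.2]
    split_ifs with h
    · exact zero_mem _
    · exact mono_mem_subspace fun b hb => hi b fun h' => hb (by simp [h'])

theorem partialDer_eq_zero {a : Θ} {s : Set Θ} (ha : a ∉ s) {f : DivPow K p S}
    (hf : f ∈ subspace K p S s) : partialDer a f = 0 := by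
  induction hf using subspace_induction with
  | zero => simp
  | add f₁ f₂ _ _ h₁ h₂ => rw [map_add, h₁, h₂, add_zero]
  | smul c f _ h => rw [Derivation.map_smul, h, smul_zero]
  | mono i hi =>
    rw [partialDer_mono a i.2, if_pos]
    by_contra h
    exact ha (hi a h)

theorem partialDer_comm (a b : Θ) (f : DivPow K p S) :
    partialDer a (partialDer b f) = partialDer b (partialDer a f) := by
  by_cases hab : a = b
  · rw [hab]
  induction f using mono_induction with
  | zero => simp
  | add f₁ f₂ h₁ h₂ => simp only [map_add, h₁, h₂]
  | smul c f h => simp only [Derivation.map_smul, h]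
  | mono i =>
    have hle : ∀ c, ∀ d, (i.1 - Finsupp.single c 1 : Θ →₀ ℕ) d < p ^ S d := fun c d =>
      lt_of_le_of_lt (Nat.sub_le (i.1 d) _) (i.2 d)
    rw [partialDer_mono a i.2, partialDer_mono b i.2]
    split_ifs with h1 h2 h2 <;> try simp only [map_zero]
    · rw [partialDer_mono b (hle a), if_pos]
      simp [h1]
    · rw [partialDer_mono a (hle b), if_pos]
      simp [h2]
    · rw [partialDer_mono a (hle b), partialDer_mono b (hle a), if_neg, if_neg, tsub_right_comm]
      · simpa [hab] using h1
      · simpa [Ne.symm hab] using h2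

theorem iterate_partialDer_mono (a : Θ) {i : Θ →₀ ℕ} (hi : ∀ b, i b < p ^ S b) (n : ℕ) :
    (partialDer a : Derivation K (DivPow K p S) _)^[n] (mono K p S i) =
      if i a < n then 0 else mono K p S (i - Finsupp.single a n) := by
  induction n with
  | zero => simp
  | succ n ih =>
    rw [Function.iterate_succ_apply', ih]
    by_cases h : i a < n
    · rw [if_pos h, if_pos (by omega), map_zero]
    · have hle : ∀ d, (i - Finsupp.single a n : Θ →₀ ℕ) d < p ^ S d := fun d =>
        lt_of_le_of_lt (by simp) (hi d)
      rw [if_neg h, partialDer_mono a hle]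
      by_cases h' : i a < n + 1
      · rw [if_pos h', if_pos]
        simp; omega
      · rw [if_neg h', if_neg, tsub_tsub, ← Finsupp.single_add]
        simp; omega

theorem iterate_partialDer_eq_zero (a : Θ) (f : DivPow K p S) :
    (partialDer a : Derivation K (DivPow K p S) _)^[p ^ S a] f = 0 := by
  have key : ((partialDer a : Derivation K (DivPow K p S) _).toLinearMap ^ p ^ S a) f = 0 := by
    induction f using mono_induction with
    | zero => simp
    | add f₁ f₂ h₁ h₂ => rw [map_add, h₁, h₂, add_zero]
    | smul c f h => rw [map_smul, h, smul_zero]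
    | mono i =>
      rw [Module.End.pow_apply]
      have := iterate_partialDer_mono (K := K) a i.2 (p ^ S a)
      rwa [if_pos (i.2 a)] at this
  rwa [Module.End.pow_apply] at key

theorem sumDer_eq_zero {c : Θ → DivPow K p S} {s : Set Θ} (hc : ∀ a ∈ s, c a = 0)
    {f : DivPow K p S} (hf : f ∈ subspace K p S s) : sumDer c f = 0 := by
  induction hf using subspace_induction with
  | zero => simp
  | add f₁ f₂ _ _ h₁ h₂ => rw [map_add, h₁, h₂, add_zero]
  | smul c f _ h => rw [Derivation.map_smul, h, smul_zero]
  | mono i hi =>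
    change sumHom c (mono K p S i.1) = 0
    rw [sumHom_mono c (Finset.Subset.refl _)]
    exact Finset.sum_eq_zero fun a ha => by rw [hc a (hi a (by simpa using ha)), zero_mul]

end DivPow

/-! ### Pivot sequences: p-powers and commutators -/

section Derivations

variable {K : Type*} [Field K] {A : Type*} [CommRing A] [Algebra K A]

theorem der_lie_smul (D E : Derivation K A A) (f : A) : ⁅D, f • E⁆ = D f • E + f • ⁅D, E⁆ := by
  ext g
  simp only [Derivation.commutator_apply, Derivation.smul_apply, Derivation.add_apply,
    smul_eq_mul, Derivation.leibniz]
  ring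

theorem der_smul_lie (D E : Derivation K A A) (f : A) : ⁅f • D, E⁆ = f • ⁅D, E⁆ - E f • D := by
  ext g
  simp only [Derivation.commutator_apply, Derivation.smul_apply, Derivation.sub_apply,
    smul_eq_mul, Derivation.leibniz]
  ring

/-- The hypothesis kills every word in a and b that contains b twice, so only the words with at most
one b survive. -/
theorem add_pow_of_mul_pow_mul_eq_zero {A : Type*} [Ring A] {a b : A}
    (h : ∀ j, b * (a ^ j * b) = 0) (n : ℕ) :
    (a + b) ^ n = a ^ n + ∑ i ∈ Finset.range n, a ^ i * b * a ^ (n - 1 - i) := by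
  induction n with
  | zero => simp
  | succ n ih =>
    have h0 : b * ∑ i ∈ Finset.range n, a ^ i * b * a ^ (n - 1 - i) = 0 := by
      rw [Finset.mul_sum]
      exact Finset.sum_eq_zero fun i _ => by rw [← mul_assoc, h, zero_mul]
    rw [pow_succ', ih, add_mul, mul_add, mul_add, h0, Finset.sum_range_succ', Finset.mul_sum,
      add_zero, add_assoc, ← pow_succ']
    congr 2
    · refine Finset.sum_congr rfl fun i hi => ?_
      rw [show n + 1 - 1 - (i + 1) = n - 1 - i by omega, pow_succ' a i]
      simp only [mul_assoc]
    · simp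

end Derivations

/-- The generation of a variable. -/
def Var.idx : Var → ℕ
  | .x n => n
  | .y n => n
  | .z n => n

/-- The variables of generation less than `n`. -/
def below (n : ℕ) : Set Var := {a | a.idx < n}

/-- The variables of generation at least `n`. -/
def above (n : ℕ) : Set Var := {a | n ≤ a.idx}

theorem below_mono {m n : ℕ} (h : m ≤ n) : below m ⊆ below n := fun _ ha => lt_of_lt_of_le ha h

section

variable {K : Type*} [Field K] {p : ℕ} {S R : ℕ → ℕ}

open DivPow

theorem exists_mem_subspace_below (f : Alg K p S R) :
    ∃ n, f ∈ subspace K p (bound S R) (below n) := by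
  obtain ⟨s, hs⟩ := exists_mem_subspace_finset f
  refine ⟨s.sup Var.idx + 1, subspace_mono (fun a ha => ?_) hs⟩
  exact Nat.lt_succ_of_le (Finset.le_sup (f := Var.idx) ha)

theorem top_mem_subspace {s : Set Var} {a : Var} (ha : a ∈ s) :
    top K p S R a ∈ subspace K p (bound S R) s :=
  mono_mem_subspace fun b hb => by
    rcases eq_or_ne a b with rfl | h
    · exact ha
    · simp [h] at hb

theorem mono_mul_mono_eq_zero {i j : Var →₀ ℕ} {a : Var} (h : p ^ bound S R a ≤ i a + j a) :
    mono K p (bound S R) i * mono K p (bound S R) j = 0 := by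
  rw [mono_mul_mono, mono_eq_zero (a := a) (by simpa using h), smul_zero]

theorem top_mul_top [Fact p.Prime] (hpos : ∀ a, 1 ≤ bound S R a) (a : Var) :
    top K p S R a * top K p S R a = 0 := by
  have hp : p.Prime := Fact.out
  have : p ^ 1 ≤ p ^ bound S R a := Nat.pow_le_pow_right hp.pos (hpos a)
  rw [pow_one] at this
  have := hp.two_le
  exact mono_mul_mono_eq_zero (a := a) (by simp; omega)

/-- The coefficient `α_i^{top} β_i^{top}`. -/
def pair (K : Type*) [Field K] (p : ℕ) (S R : ℕ → ℕ) (a b : Var) : Alg K p S R :=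
  top K p S R a * top K p S R b

theorem pair_mem_subspace {s : Set Var} {a b : Var} (ha : a ∈ s) (hb : b ∈ s) :
    pair K p S R a b ∈ subspace K p (bound S R) s :=
  mul_mem_subspace (top_mem_subspace ha) (top_mem_subspace hb)

end

open DivPow in
/-- A sequence of derivations that satisfy the recursion
`D_i = ∂_{α_i} + α_i^{top} β_i^{top} D_{i+1}`, where `D_i` involves only derivatives with respect to
variables of generation at least `i`. -/
structure IsPivot {K : Type*} [Field K] {p : ℕ} {S R : ℕ → ℕ} [Fact p.Prime] [CharP K p]
    (α β : ℕ → Var) (D : ℕ → Derivation K (Alg K p S R) (Alg K p S R)) : Prop where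
  idx_left : ∀ i, (α i).idx = i
  idx_right : ∀ i, (β i).idx = i
  ne : ∀ i, α i ≠ β i
  eq_add : ∀ i, D i = partialDer (α i) + (top K p S R (α i) * top K p S R (β i)) • D (i + 1)
  eq_zero : ∀ i, ∀ f ∈ subspace K p (bound S R) (below i), D i f = 0

section

open DivPow

variable (K : Type*) [Field K] (p : ℕ) (S R : ℕ → ℕ) [Fact p.Prime] [CharP K p]

theorem isPivot_v : IsPivot (K := K) (p := p) Var.x Var.y (v K p S R) where
  idx_left _ := rfl
  idx_right _ := rfl
  ne _ := by simp
  eq_add := v_recursion K p S R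
  eq_zero i _ hf := sumDer_eq_zero (fun a ha => by
    cases a with
    | x j => exact if_neg (not_le.2 ha)
    | _ => rfl) hf

theorem isPivot_w : IsPivot (K := K) (p := p) Var.y Var.x (w K p S R) where
  idx_left _ := rfl
  idx_right _ := rfl
  ne _ := by simp
  eq_add := w_recursion K p S R
  eq_zero i _ hf := sumDer_eq_zero (fun a ha => by
    cases a with
    | y j => exact if_neg (not_le.2 ha)
    | _ => rfl) hf

theorem isPivot_u : IsPivot (K := K) (p := p) Var.z Var.x (u K p S R) where
  idx_left _ := rfl
  idx_right _ := rfl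
  ne _ := by simp
  eq_add := u_recursion K p S R
  eq_zero i _ hf := sumDer_eq_zero (fun a ha => by
    cases a with
    | z j => exact if_neg (not_le.2 ha)
    | _ => rfl) hf

end

section

open DivPow

variable {K : Type*} [Field K] {p : ℕ} {S R : ℕ → ℕ} [Fact p.Prime] [CharP K p]

namespace IsPivot

variable {α β : ℕ → Var} {D : ℕ → Derivation K (Alg K p S R) (Alg K p S R)}

theorem apply_eq (hD : IsPivot α β D) (i : ℕ) (f : Alg K p S R) :
    D i f = partialDer (α i) f + pair K p S R (α i) (β i) * D (i + 1) f := by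
  rw [hD.eq_add i]; rfl

/-- Properties of `D_i f` may be proved by descending induction on `i`. -/
theorem apply_induction (hD : IsPivot α β D) {f : Alg K p S R} {P : ℕ → Alg K p S R → Prop}
    (zero : ∀ i, P i 0)
    (step : ∀ i g, P (i + 1) g → P i (partialDer (α i) f + pair K p S R (α i) (β i) * g)) (i : ℕ) :
    P i (D i f) := by
  -- f involves finitely many generations, so D_i f = 0 for all large i; the descending induction
  -- starts there.
  obtain ⟨n, hn⟩ := exists_mem_subspace_below f
  have key : ∀ d i, n ≤ i + d → P i (D i f) := by
    intro d
    induction d with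
    | zero =>
      intro i hi
      rw [hD.eq_zero i f (subspace_mono (below_mono hi) hn)]
      exact zero i
    | succ d ih =>
      intro i hi
      rw [hD.apply_eq]
      exact step _ _ (ih _ (by omega))
  exact key n i (by omega)

theorem mem_above (hD : IsPivot α β D) {n i : ℕ} (hi : n ≤ i) {f : Alg K p S R}
    (hf : f ∈ subspace K p (bound S R) (above n)) :
    D i f ∈ subspace K p (bound S R) (above n) := by
  refine hD.apply_induction (f := f)
    (P := fun i g => n ≤ i → g ∈ subspace K p (bound S R) (above n)) (fun _ _ => zero_mem _)
    (fun i g hg hi => add_mem (partialDer_mem_subspace _ hf) (mul_mem_subspace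
      (pair_mem_subspace ?_ ?_) (hg (by omega)))) i hi
  · exact hi.trans (hD.idx_left i).ge
  · exact hi.trans (hD.idx_right i).ge

theorem mem_below (hD : IsPivot α β D) {n : ℕ} (i : ℕ) {f : Alg K p S R}
    (hf : f ∈ subspace K p (bound S R) (below n)) :
    D i f ∈ subspace K p (bound S R) (below n) := by
  rcases le_or_gt n i with hi | hi
  · rw [hD.eq_zero i f (subspace_mono (below_mono hi) hf)]
    exact zero_mem _
  have key : ∀ d i, n = i + d → D i f ∈ subspace K p (bound S R) (below n) := by
    intro d
    induction d with
    | zero =>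
      rintro i rfl
      rw [hD.eq_zero _ f hf]
      exact zero_mem _
    | succ d ih =>
      intro i hi
      rw [hD.apply_eq]
      refine add_mem (partialDer_mem_subspace _ hf) (mul_mem_subspace
        (pair_mem_subspace ?_ ?_) (ih _ (by omega)))
      · exact (hD.idx_left i).trans_lt (by omega)
      · exact (hD.idx_right i).trans_lt (by omega)
  exact key (n - i) i (by omega)

/-- The coefficients of D_i involve only generations at least i, so ∂_a treats them as constants. -/
theorem partialDer_comm (hD : IsPivot α β D) {a : Var} {i : ℕ} (ha : a.idx < i)
    (f : Alg K p S R) : partialDer a (D i f) = D i (partialDer a f) := by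
  obtain ⟨n, hn⟩ := exists_mem_subspace_below f
  have key : ∀ d i, n ≤ i + d → a.idx < i → partialDer a (D i f) = D i (partialDer a f) := by
    intro d
    induction d with
    | zero =>
      intro i hi _
      have hn' := subspace_mono (below_mono hi) hn
      rw [hD.eq_zero i f hn', hD.eq_zero i _ (partialDer_mem_subspace _ hn'), map_zero]
    | succ d ih =>
      intro i hi hai
      have h0 : partialDer a (pair K p S R (α i) (β i)) = 0 :=
        partialDer_eq_zero (s := above i) (not_le.2 hai)
          (pair_mem_subspace (hD.idx_left i).ge (hD.idx_right i).ge)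
      rw [hD.apply_eq, hD.apply_eq i (partialDer a f), map_add, Derivation.leibniz, h0, ih _ (by omega) (by omega),
        DivPow.partialDer_comm]
      simp
  exact key n i (by omega) ha

theorem lie_partialDer (hD : IsPivot α β D) {a : Var} {i : ℕ} (ha : a.idx < i) :
    ⁅(partialDer a : Derivation K (Alg K p S R) _), D i⁆ = 0 := by
  ext f
  rw [Derivation.commutator_apply, hD.partialDer_comm ha, sub_self]
  rfl

theorem iterate_adHom_partialDer {a : Var} {E : Derivation K (Alg K p S R) (Alg K p S R)}
    (hE : ⁅(partialDer a : Derivation K (Alg K p S R) _), E⁆ = 0) (f : Alg K p S R) (n : ℕ) :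
    (adHom K (partialDer a : Derivation K (Alg K p S R) _).toLinearMap ^ n) (f • E).toLinearMap =
      (((partialDer a : Derivation K (Alg K p S R) _)^[n] f) • E).toLinearMap := by
  induction n with
  | zero => rfl
  | succ n ih =>
    rw [pow_succ', Module.End.mul_apply, ih, adHom_apply, Function.iterate_succ_apply',
      ← Derivation.commutator_coe_linear_map, der_lie_smul, hE, smul_zero, add_zero]

/-- `D_i ^ (p ^ bound) = β_i^{top} D_{i+1}`. -/
theorem pow_eq (hD : IsPivot α β D) (hpos : ∀ a, 1 ≤ bound S R a) (i : ℕ) :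
    (D i).toLinearMap ^ p ^ bound S R (α i) =
      (top K p S R (β i) • D (i + 1)).toLinearMap := by
  set d : Derivation K (Alg K p S R) (Alg K p S R) := partialDer (α i) with hd
  set E : Derivation K (Alg K p S R) (Alg K p S R) := top K p S R (β i) • D (i + 1) with hE
  have hp : p.Prime := Fact.out
  have hdβ : d (top K p S R (β i)) = 0 :=
    partialDer_eq_zero (s := {β i}) (by simpa using hD.ne i) (top_mem_subspace rfl)
  have hdE : ⁅d, E⁆ = 0 := by
    rw [hE, der_lie_smul, hdβ, hD.lie_partialDer ((hD.idx_left i).trans_lt (Nat.lt_succ_self i)),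
      smul_zero, zero_smul, add_zero]
  have hcomm : ∀ n f, E (d^[n] f) = d^[n] (E f) := by
    intro n
    induction n with
    | zero => intro f; rfl
    | succ n ih =>
      intro f
      rw [Function.iterate_succ_apply, Function.iterate_succ_apply, ih]
      have := congrArg (fun D : Derivation K (Alg K p S R) _ => D f) hdE
      simp only [Derivation.commutator_apply, Derivation.zero_apply, sub_eq_zero] at this
      rw [this]
  have hkill : ∀ a : Var, a.idx = i → D (i + 1) (top K p S R a) = 0 := fun a ha =>
    hD.eq_zero _ _ (top_mem_subspace (ha.trans_lt (Nat.lt_succ_self i)))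
  have hEE : ∀ f g, E (top K p S R (α i) * g) = top K p S R (α i) * E g ∧ E (E f) = 0 := by
    intro f g
    have h1 := hkill _ (hD.idx_left i)
    have h2 := hkill _ (hD.idx_right i)
    refine ⟨?_, ?_⟩
    · simp only [hE, Derivation.smul_apply, Derivation.leibniz, h1, smul_eq_mul]; ring
    · simp only [hE, Derivation.smul_apply, Derivation.leibniz, h2, smul_eq_mul]
      rw [← mul_assoc, top_mul_top hpos]; ring
  have hDi : (D i).toLinearMap = d.toLinearMap + (top K p S R (α i) • E).toLinearMap := by
    rw [hD.eq_add i, hE, smul_smul]; rfl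
  -- E commutes with d, and E² = 0 because (β_i^{top})² = 0 and D_{i+1} kills β_i^{top}.
  have hzero : ∀ j, (top K p S R (α i) • E).toLinearMap *
      (d.toLinearMap ^ j * (top K p S R (α i) • E).toLinearMap) = 0 := by
    intro j
    refine LinearMap.ext fun f => ?_
    rw [Module.End.mul_apply, Module.End.mul_apply, Module.End.pow_apply]
    change top K p S R (α i) * E (d^[j] (top K p S R (α i) * E f)) = 0
    rw [hcomm, (hEE f (E f)).1, (hEE f f).2, mul_zero, show d^[j] 0 = 0 from
      Function.iterate_fixed (map_zero d) j, mul_zero]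
  -- The words with a single factor α_i^{top} E sum to ad(d)^{p^s - 1}(α_i^{top} E), where s is the
  -- bound of α_i. This differentiates α_i^{top} down to 1 and leaves E; the word d^{p^s} is zero.
  rw [hDi, add_pow_of_mul_pow_mul_eq_zero hzero, sum_pow_mul_mul_pow (K := K) p,
    iterate_adHom_partialDer hdE]
  have h1 : d.toLinearMap ^ p ^ bound S R (α i) = 0 := LinearMap.ext fun f => by
    rw [Module.End.pow_apply]
    exact iterate_partialDer_eq_zero _ f
  have hlt : ∀ b, Finsupp.single (α i) (p ^ bound S R (α i) - 1) b < p ^ bound S R b := by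
    intro b
    have := Nat.pow_pos (n := bound S R b) hp.pos
    rcases eq_or_ne (α i) b with rfl | h
    · simp; omega
    · simpa [h] using this
  rw [h1, zero_add, top, iterate_partialDer_mono _ hlt, if_neg (by simp), tsub_self]
  exact congrArg _ (one_smul _ _)

/-- Bracketing with `D_i` lowers the exponent of `α_i` in `f • E` by one, if that exponent is
positive. -/
theorem lie_smul_eq (hD : IsPivot α β D) {i : ℕ} {E : Derivation K (Alg K p S R) (Alg K p S R)}
    (hE : ⁅(partialDer (α i) : Derivation K (Alg K p S R) _), E⁆ = 0)
    (hE0 : E (pair K p S R (α i) (β i)) = 0) {f : Alg K p S R} (hf : top K p S R (α i) * f = 0) :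
    ⁅D i, f • E⁆ = partialDer (α i) f • E := by
  have hq : pair K p S R (α i) (β i) * f = 0 := by
    rw [pair, mul_right_comm, hf, zero_mul]
  have hDq : D (i + 1) (pair K p S R (α i) (β i)) = 0 :=
    hD.eq_zero _ _ (pair_mem_subspace ((hD.idx_left i).trans_lt (Nat.lt_succ_self i))
      ((hD.idx_right i).trans_lt (Nat.lt_succ_self i)))
  -- D_{i+1} is linear over generation i, so this is D_{i+1} of the vanishing product of `pair` and
  -- f.
  have h1 : pair K p S R (α i) (β i) * D (i + 1) f = 0 := by
    have := congrArg (D (i + 1)) hq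
    rwa [Derivation.leibniz, hDq, smul_zero, add_zero, map_zero] at this
  have h2 : ⁅D i, E⁆ = pair K p S R (α i) (β i) • ⁅D (i + 1), E⁆ := by
    have : D i = partialDer (α i) + pair K p S R (α i) (β i) • D (i + 1) := hD.eq_add i
    rw [this, add_lie, hE, der_smul_lie, hE0, zero_smul, sub_zero, zero_add]
  rw [der_lie_smul, hD.apply_eq, h1, add_zero, h2, smul_smul, mul_comm, hq, zero_smul, add_zero]

end IsPivot

end

end Clover

end

/-! ### Weights and the lower bound -/

noncomputable section

namespace Clover

open DivPow

instance : DecidableEq Var := Classical.decEq Var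

theorem single_apply_of_idx_ne {a b : Var} (h : b.idx ≠ a.idx) (k : ℕ) :
    Finsupp.single a k b = 0 :=
  Finsupp.single_eq_of_ne fun h' => h (by rw [h'])

/-- The degree of the pivot elements of generation `n` with respect to the standard generators. -/
def scale (p : ℕ) (S R : ℕ → ℕ) (n : ℕ) : ℕ :=
  ∏ i ∈ Finset.range n, (p ^ S i + p ^ R i - 1)

theorem scale_zero (p : ℕ) (S R : ℕ → ℕ) : scale p S R 0 = 1 := rfl

theorem scale_succ (p : ℕ) (S R : ℕ → ℕ) (n : ℕ) :
    scale p S R (n + 1) = scale p S R n * (p ^ S n + p ^ R n - 1) :=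
  Finset.prod_range_succ _ _

/-- The weight of a monomial: a variable of generation `n` has weight `scale n`. -/
def wt (p : ℕ) (S R : ℕ → ℕ) : (Var →₀ ℕ) →+ ℕ :=
  Finsupp.weight fun a => scale p S R a.idx

theorem wt_single (p : ℕ) (S R : ℕ → ℕ) (a : Var) (k : ℕ) :
    wt p S R (Finsupp.single a k) = k * scale p S R a.idx := by
  simp [wt, Finsupp.weight_single]

/-- The exponents of the product of the top divided powers of all variables of generation less
than `n`. -/
def full (p : ℕ) (S R : ℕ → ℕ) (n : ℕ) : Var →₀ ℕ :=
  ∑ i ∈ Finset.range n, (Finsupp.single (Var.x i) (p ^ S i - 1) +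
    Finsupp.single (Var.y i) (p ^ R i - 1) + Finsupp.single (Var.z i) (p ^ R i - 1))

section

variable (p : ℕ) (S R : ℕ → ℕ)

theorem full_succ (n : ℕ) : full p S R (n + 1) = full p S R n +
    (Finsupp.single (Var.x n) (p ^ S n - 1) + Finsupp.single (Var.y n) (p ^ R n - 1) +
      Finsupp.single (Var.z n) (p ^ R n - 1)) :=
  Finset.sum_range_succ _ _

theorem full_apply (n : ℕ) (a : Var) :
    full p S R n a = if a.idx < n then p ^ bound S R a - 1 else 0 := by
  induction n with
  | zero => simp [full]
  | succ n ih =>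
    rw [full_succ, Finsupp.add_apply, ih]
    cases a with
    | x i =>
      rcases eq_or_ne i n with rfl | h
      · simp [Var.idx, bound]
      · have h' : i < n + 1 ↔ i < n := by omega
        by_cases h'' : i < n <;> simp [Var.idx, h.symm, h', h'', bound]
    | y i =>
      rcases eq_or_ne i n with rfl | h
      · simp [Var.idx, bound]
      · have h' : i < n + 1 ↔ i < n := by omega
        by_cases h'' : i < n <;> simp [Var.idx, h.symm, h', h'', bound]
    | z i =>
      rcases eq_or_ne i n with rfl | h
      · simp [Var.idx, bound]
      · have h' : i < n + 1 ↔ i < n := by omega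
        by_cases h'' : i < n <;> simp [Var.idx, h.symm, h', h'', bound]

theorem le_full_iff [Fact p.Prime] {n : ℕ} {i : Var →₀ ℕ} :
    i ≤ full p S R n ↔ (∀ a, i a < p ^ bound S R a) ∧ ∀ a, i a ≠ 0 → a ∈ below n := by
  have hp : p.Prime := Fact.out
  constructor
  · intro h
    refine ⟨fun a => ?_, fun a ha => ?_⟩
    · have h1 := h a
      have h2 := Nat.pow_pos (n := bound S R a) hp.pos
      rw [full_apply] at h1
      split_ifs at h1 <;> omega
    · by_contra hn
      have h1 := h a
      rw [full_apply, if_neg (show ¬a.idx < n from hn)] at h1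
      omega
  · rintro ⟨h1, h2⟩ a
    rw [full_apply]
    by_cases h0 : i a = 0
    · omega
    · rw [if_pos (show a.idx < n from h2 a h0)]
      have := h1 a
      omega

/-- The dimension of the algebra of divided powers in the variables of generation less than `n`. -/
def boxCard (n : ℕ) : ℕ := p ^ ∑ i ∈ Finset.range n, (S i + 2 * R i)

theorem boxCard_succ (n : ℕ) : boxCard p S R (n + 1) =
    boxCard p S R n * (p ^ S n * p ^ R n * p ^ R n) := by
  rw [boxCard, Finset.sum_range_succ, pow_add, boxCard]
  ring

variable [Fact p.Prime]

theorem card_Iic_full (n : ℕ) : (Finset.Iic (full p S R n)).card = boxCard p S R n := by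
  have hp : p.Prime := Fact.out
  have key : (full p S R n).prod (fun _ k => k + 1) = boxCard p S R n := by
    induction n with
    | zero => simp [full, boxCard]
    | succ n ih =>
      have h1 : ∀ k, p ^ k - 1 + 1 = p ^ k := fun k => Nat.sub_add_cancel (Nat.pow_pos hp.pos)
      have hd1 : Disjoint (Finsupp.single (Var.x n) (p ^ S n - 1)).support
          (Finsupp.single (Var.y n) (p ^ R n - 1)).support :=
        Finset.disjoint_of_subset_left Finsupp.support_single_subset
          (Finset.disjoint_of_subset_right Finsupp.support_single_subset (by simp))
      have hd2 : Disjoint (Finsupp.single (Var.x n) (p ^ S n - 1) +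
          Finsupp.single (Var.y n) (p ^ R n - 1)).support
          (Finsupp.single (Var.z n) (p ^ R n - 1)).support := by
        rw [Finset.disjoint_left]
        intro a ha hb
        have := Finset.mem_singleton.1 (Finsupp.support_single_subset hb)
        subst this
        simp at ha
      have hd3 : Disjoint (full p S R n).support (Finsupp.single (Var.x n) (p ^ S n - 1) +
          Finsupp.single (Var.y n) (p ^ R n - 1) +
          Finsupp.single (Var.z n) (p ^ R n - 1)).support := by
        rw [Finset.disjoint_left]
        intro a ha hb
        have ha' : a.idx < n := by
          by_contra h
          rw [Finsupp.mem_support_iff, full_apply, if_neg h] at ha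
          exact ha rfl
        rw [Finsupp.mem_support_iff, Finsupp.add_apply, Finsupp.add_apply,
          single_apply_of_idx_ne ha'.ne, single_apply_of_idx_ne ha'.ne,
          single_apply_of_idx_ne ha'.ne] at hb
        exact hb rfl
      rw [full_succ, Finsupp.prod_add_index_of_disjoint hd3,
        Finsupp.prod_add_index_of_disjoint hd2, Finsupp.prod_add_index_of_disjoint hd1, ih,
        Finsupp.prod_single_index rfl, Finsupp.prod_single_index rfl,
        Finsupp.prod_single_index rfl, h1, h1, boxCard_succ]
  rw [Finsupp.card_Iic, ← key]
  simp [Finsupp.prod]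

/-- With c = `scale n`, generation n contributes (p^{S_n} + 2p^{R_n} - 3)c to the weight, which is
(p^{S_n} + 1)c ≥ 3c less than 2 · `scale (n+1)`. Induction spends 2c of this on the earlier
generations. The remaining c is the slack that the upper bound needs for words of length at most
`scale n`. -/
theorem wt_full_add_le (hS : ∀ i, 1 ≤ S i) (n : ℕ) :
    wt p S R (full p S R (n + 1)) + scale p S R n + 2 ≤ 2 * scale p S R (n + 1) := by
  have hp : p.Prime := Fact.out
  have step : ∀ n, wt p S R (full p S R n) + 2 ≤ 2 * scale p S R n →
      wt p S R (full p S R (n + 1)) + scale p S R n + 2 ≤ 2 * scale p S R (n + 1) := by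
    intro n h
    have h1 : p ^ 1 ≤ p ^ S n := Nat.pow_le_pow_right hp.pos (hS n)
    have h2 := hp.two_le
    have h3 : 1 ≤ p ^ R n := Nat.pow_pos hp.pos
    rw [pow_one] at h1
    rw [full_succ, map_add, map_add, map_add, wt_single, wt_single, wt_single, scale_succ]
    simp only [Var.idx]
    obtain ⟨a, ha⟩ : ∃ a, p ^ S n = a + 2 := ⟨p ^ S n - 2, by omega⟩
    obtain ⟨b, hb⟩ : ∃ b, p ^ R n = b + 1 := ⟨p ^ R n - 1, by omega⟩
    rw [ha, hb, show a + 2 - 1 = a + 1 by omega, show b + 1 - 1 = b by omega,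
      show a + 2 + (b + 1) - 1 = a + b + 2 by omega]
    nlinarith [Nat.zero_le (a * scale p S R n)]
  refine step n ?_
  induction n with
  | zero => simp [full, scale]
  | succ n ih => have := step n ih; omega

theorem wt_full_le (hS : ∀ i, 1 ≤ S i) (n : ℕ) :
    wt p S R (full p S R n) ≤ 2 * scale p S R n := by
  cases n with
  | zero => simp [full]
  | succ n => have := wt_full_add_le p S R hS n; omega

theorem scale_pos (n : ℕ) : 0 < scale p S R n := by
  have hp : p.Prime := Fact.out
  refine Finset.prod_pos fun i _ => ?_
  have h1 := Nat.pow_pos (n := S i) hp.pos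
  have h2 := Nat.pow_pos (n := R i) hp.pos
  omega

end

section

variable {K : Type*} [Field K] {p : ℕ} {S R : ℕ → ℕ} [Fact p.Prime] [CharP K p]
  {F : ℕ → Submodule K (Module.End K (Alg K p S R))}

/-- Each bracket with D_i costs degree l and removes one unit of the exponent of α_i, so k brackets
strip α_i^{(k)} from a monomial. -/
theorem IsPivot.lower_mem {α β : ℕ → Var} {D : ℕ → Derivation K (Alg K p S R) (Alg K p S R)}
    (hD : IsPivot α β D) (hF : IsRestrictedFiltration p F) {i l : ℕ}
    (hl : (D i).toLinearMap ∈ F l) {E : Derivation K (Alg K p S R) (Alg K p S R)}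
    (hE : ⁅(partialDer (α i) : Derivation K (Alg K p S R) _), E⁆ = 0)
    (hE0 : E (pair K p S R (α i) (β i)) = 0) {m : Var →₀ ℕ} (k : ℕ)
    (hm : ∀ b, (m + Finsupp.single (α i) k : Var →₀ ℕ) b < p ^ bound S R b) {L : ℕ}
    (h : (mono K p (bound S R) (m + Finsupp.single (α i) k) • E).toLinearMap ∈ F L) :
    (mono K p (bound S R) m • E).toLinearMap ∈ F (L + k * l) := by
  have hp : p.Prime := Fact.out
  induction k generalizing L with
  | zero => simpa using h
  | succ k ih =>
    rw [Finsupp.single_add, ← add_assoc] at h hm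
    have h0 : top K p S R (α i) *
        mono K p (bound S R) (m + Finsupp.single (α i) k + Finsupp.single (α i) 1) = 0 := by
      have := Nat.pow_pos (n := bound S R (α i)) hp.pos
      refine mono_mul_mono_eq_zero (a := α i) ?_
      simp
      omega
    have h1 := hF.lie_mem hl h
    rw [← Derivation.commutator_coe_linear_map, hD.lie_smul_eq hE hE0 h0,
      partialDer_mono_add hm] at h1
    have h2 := ih (fun b => lt_of_le_of_lt (by simp) (hm b)) h1
    rwa [show l + L + k * l = L + (k + 1) * l by ring] at h2

/-- Climbing one generation: the p-power of D_n is β_n^{top} D_{n+1}, and brackets with D'_n, whose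
leading derivative is along β_n, strip β_n^{top}. -/
theorem IsPivot.succ_mem {α β β' : ℕ → Var}
    {D D' : ℕ → Derivation K (Alg K p S R) (Alg K p S R)} (hD : IsPivot α β D)
    (hD' : IsPivot β β' D') (hF : IsRestrictedFiltration p F) (hpos : ∀ a, 1 ≤ bound S R a)
    {n s : ℕ} (h : (D n).toLinearMap ∈ F s) (h' : (D' n).toLinearMap ∈ F s) :
    (D (n + 1)).toLinearMap ∈
      F (s * p ^ bound S R (α n) + (p ^ bound S R (β n) - 1) * s) := by
  have hp : p.Prime := Fact.out
  have h1 := hF.pow_pow_mem h (bound S R (α n))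
  rw [hD.pow_eq hpos] at h1
  have h2 := hD'.lower_mem hF h' (E := D (n + 1)) (m := 0) (L := s * p ^ bound S R (α n))
    (hD.lie_partialDer ((hD.idx_right n).trans_lt (Nat.lt_succ_self n)))
    (hD.eq_zero _ _ (pair_mem_subspace ((hD.idx_right n).trans_lt (Nat.lt_succ_self n))
      ((hD'.idx_right n).trans_lt (Nat.lt_succ_self n)))) (p ^ bound S R (β n) - 1) ?_ ?_
  · rwa [← one_def, one_smul] at h2
  · intro b
    have := Nat.pow_pos (n := bound S R b) hp.pos
    rcases eq_or_ne (β n) b with rfl | hb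
    · simp; omega
    · simpa [hb] using this
  · rwa [zero_add]

theorem pivots_mem (hF : IsRestrictedFiltration p F) (hpos : ∀ a, 1 ≤ bound S R a)
    (hg : gens K p S R ⊆ F 1) (n : ℕ) :
    (v K p S R n).toLinearMap ∈ F (scale p S R n) ∧
      (w K p S R n).toLinearMap ∈ F (scale p S R n) ∧
      (u K p S R n).toLinearMap ∈ F (scale p S R n) := by
  have hp : p.Prime := Fact.out
  induction n with
  | zero => exact ⟨hg (by simp [gens]), hg (by simp [gens]), hg (by simp [gens])⟩
  | succ n ih =>
    obtain ⟨hv, hw, hu⟩ := ih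
    have h1 := Nat.pow_pos (n := S n) hp.pos
    have h2 := Nat.pow_pos (n := R n) hp.pos
    -- The p-power multiplies the degree by one of p^{S_n}, p^{R_n}, and the stripping costs the
    -- other one minus 1. The total factor p^{S_n} + p^{R_n} - 1 is symmetric, so all three pivots
    -- keep a common degree.
    have e1 : scale p S R n * p ^ S n + (p ^ R n - 1) * scale p S R n = scale p S R (n + 1) := by
      rw [scale_succ, mul_comm (p ^ R n - 1), ← mul_add]; congr 1; omega
    have e2 : scale p S R n * p ^ R n + (p ^ S n - 1) * scale p S R n = scale p S R (n + 1) := by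
      rw [scale_succ, mul_comm (p ^ S n - 1), ← mul_add]; congr 1; omega
    refine ⟨?_, ?_, ?_⟩
    · rw [← e1]; exact (isPivot_v K p S R).succ_mem (isPivot_w K p S R) hF hpos hv hw
    · rw [← e2]; exact (isPivot_w K p S R).succ_mem (isPivot_v K p S R) hF hpos hw hv
    · rw [← e2]; exact (isPivot_u K p S R).succ_mem (isPivot_v K p S R) hF hpos hu hv

theorem exists_isPivot_mem (hF : IsRestrictedFiltration p F) (hpos : ∀ a, 1 ≤ bound S R a)
    (hg : gens K p S R ⊆ F 1) (a : Var) :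
    ∃ (α β : ℕ → Var) (D : ℕ → Derivation K (Alg K p S R) (Alg K p S R)), IsPivot α β D ∧
      α a.idx = a ∧ (D a.idx).toLinearMap ∈ F (scale p S R a.idx) := by
  have h := pivots_mem hF hpos hg a.idx
  cases a with
  | x n => exact ⟨_, _, _, isPivot_v K p S R, rfl, h.1⟩
  | y n => exact ⟨_, _, _, isPivot_w K p S R, rfl, h.2.1⟩
  | z n => exact ⟨_, _, _, isPivot_u K p S R, rfl, h.2.2⟩

/-- Every variable is the leading variable of exactly the kind of pivot available in degree equal to
its weight. Stripping d therefore costs exactly its weight. -/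
theorem lower_all_mem (hF : IsRestrictedFiltration p F) (hpos : ∀ a, 1 ≤ bound S R a)
    (hg : gens K p S R ⊆ F 1) {n : ℕ} (d m : Var →₀ ℕ) (hd : ∀ a, d a ≠ 0 → a ∈ below n)
    (hm : ∀ b, (m + d) b < p ^ bound S R b) {L : ℕ}
    (h : (mono K p (bound S R) (m + d) • u K p S R n).toLinearMap ∈ F L) :
    (mono K p (bound S R) m • u K p S R n).toLinearMap ∈ F (L + wt p S R d) := by
  induction d using Finsupp.induction generalizing m L with
  | zero => simpa using h
  | single_add a k d ha hk ih =>
    have hu := isPivot_u K p S R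
    have haz : d a = 0 := Finsupp.notMem_support_iff.1 ha
    have han : a.idx < n := hd a (by simp [haz, hk])
    have e : m + (Finsupp.single a k + d) = m + d + Finsupp.single a k := by
      rw [add_comm (Finsupp.single a k), add_assoc]
    rw [e] at h hm
    obtain ⟨α, β, D, hD, hαa, hDa⟩ := exists_isPivot_mem hF hpos hg a
    rw [← hαa] at h hm
    have h1 := hD.lower_mem hF hDa (hu.lie_partialDer ((hD.idx_left _).trans_lt han))
      (hu.eq_zero _ _ (pair_mem_subspace ((hD.idx_left _).trans_lt han)
        ((hD.idx_right _).trans_lt han))) k hm h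
    rw [map_add, wt_single, ← add_assoc]
    refine ih m (fun b hb => hd b ?_) (fun b => lt_of_le_of_lt (by simp) (hm b)) h1
    rw [Finsupp.add_apply]
    omega

/-- `[v_n, u_n] = z_n^{top} x_n^{(top - 1)} u_{n+1}`. -/
theorem lie_v_u (hpos : ∀ a, 1 ≤ bound S R a) (n : ℕ) : ⁅v K p S R n, u K p S R n⁆ =
    mono K p (bound S R) (Finsupp.single (Var.z n) (p ^ R n - 1) +
      Finsupp.single (Var.x n) (p ^ S n - 1 - 1)) • u K p S R (n + 1) := by
  have hp : p.Prime := Fact.out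
  have hv := isPivot_v K p S R
  have hu := isPivot_u K p S R
  have h2 : p ^ 1 ≤ p ^ S n := Nat.pow_le_pow_right hp.pos (hpos (.x n))
  rw [pow_one] at h2
  have h2' := hp.two_le
  have hRp := Nat.pow_pos (n := R n) hp.pos
  have e : pair K p S R (.z n) (.x n) = mono K p (bound S R)
      (Finsupp.single (Var.z n) (p ^ R n - 1) + Finsupp.single (Var.x n) (p ^ S n - 1 - 1) +
        Finsupp.single (Var.x n) 1) := by
    rw [pair, top, top, mono_mul_mono_of_disjoint, add_assoc, ← Finsupp.single_add]
    · simp only [bound]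
      rw [Nat.sub_add_cancel (by omega)]
    · intro a
      rcases eq_or_ne (Var.z n) a with rfl | h
      · right; simp
      · left; simp [h]
  have h1 : ⁅v K p S R n, (partialDer (.z n) : Derivation K (Alg K p S R) _)⁆ = 0 := by
    have hz : (partialDer (.z n) : Derivation K (Alg K p S R) _)
        (pair K p S R (.x n) (.y n)) = 0 :=
      partialDer_eq_zero (s := {.x n, .y n}) (by simp) (pair_mem_subspace (by simp) (by simp))
    have hd : ⁅(partialDer (.x n) : Derivation K (Alg K p S R) _),
        (partialDer (.z n) : Derivation K (Alg K p S R) _)⁆ = 0 := by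
      ext f
      rw [Derivation.commutator_apply, DivPow.partialDer_comm, sub_self]; rfl
    have : v K p S R n = partialDer (.x n) + pair K p S R (.x n) (.y n) • v K p S R (n + 1) :=
      hv.eq_add n
    rw [this, add_lie, hd, der_smul_lie, hz, ← lie_skew,
      hv.lie_partialDer (Nat.lt_succ_self n : (Var.z n).idx < n + 1)]
    simp
  have hun : u K p S R n = partialDer (.z n) + pair K p S R (.z n) (.x n) • u K p S R (n + 1) :=
    hu.eq_add n
  -- v_n commutes with ∂_{z_n}, so only the tail of u_n contributes; there v_n lowers x_n^{top} by
  -- one.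
  rw [hun, lie_add, h1, zero_add, hv.lie_smul_eq
    (hu.lie_partialDer (Nat.lt_succ_self n : (Var.x n).idx < n + 1)), e, partialDer_mono_add]
  · intro b
    rw [add_assoc, ← Finsupp.single_add, Nat.sub_add_cancel (by omega)]
    have := Nat.pow_pos (n := bound S R b) hp.pos
    cases b with
    | x i =>
      rcases eq_or_ne n i with rfl | h
      · simp [bound]; omega
      · simpa [h] using this
    | y i => simpa using this
    | z i =>
      rcases eq_or_ne n i with rfl | h
      · simp [bound]; omega
      · simpa [h] using this
  · exact hu.eq_zero _ _ (pair_mem_subspace (Nat.lt_succ_self n : (Var.x n).idx < n + 1)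
      (Nat.lt_succ_self n : (Var.y n).idx < n + 1))
  · rw [pair, mul_comm, mul_assoc, top_mul_top hpos, mul_zero]

theorem lower_x_mem (hF : IsRestrictedFiltration p F) (hpos : ∀ a, 1 ≤ bound S R a)
    (hg : gens K p S R ⊆ F 1) {n L : ℕ}
    (h : (mono K p (bound S R) (full p S R n + (Finsupp.single (Var.z n) (p ^ R n - 1) +
      Finsupp.single (Var.x n) (p ^ S n - 1 - 1))) • u K p S R (n + 1)).toLinearMap ∈ F L) :
    (mono K p (bound S R) (full p S R n + Finsupp.single (Var.z n) (p ^ R n - 1)) •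
      u K p S R (n + 1)).toLinearMap ∈ F (L + (p ^ S n - 1 - 1) * scale p S R n) := by
  have hp : p.Prime := Fact.out
  rw [← add_assoc] at h
  refine (wt_single p S R (.x n) _) ▸ lower_all_mem hF hpos hg _ _ (fun a ha => ?_)
    (fun b => ?_) h
  · rcases eq_or_ne (Var.x n) a with rfl | hn
    · exact Nat.lt_succ_self n
    · simp [hn] at ha
  · have hb := Nat.pow_pos (n := bound S R b) hp.pos
    rw [Finsupp.add_apply, Finsupp.add_apply, full_apply]
    cases b with
    | x i =>
      rcases eq_or_ne n i with rfl | h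
      · simp [bound, Var.idx] at hb ⊢; omega
      · simp [h]; split_ifs <;> omega
    | y i => simp; split_ifs <;> omega
    | z i =>
      rcases eq_or_ne n i with rfl | h
      · simp [bound, Var.idx] at hb ⊢; omega
      · simp [h]; split_ifs <;> omega

/-- The element `(∏ of all top divided powers of generation < n) z_n^{top} u_{n+1}`. -/
theorem full_smul_mem (hF : IsRestrictedFiltration p F) (hpos : ∀ a, 1 ≤ bound S R a)
    (hg : gens K p S R ⊆ F 1) (n : ℕ) :
    (mono K p (bound S R) (full p S R n + Finsupp.single (Var.z n) (p ^ R n - 1)) •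
      u K p S R (n + 1)).toLinearMap ∈ F (scale p S R (n + 1)) := by
  have hp : p.Prime := Fact.out
  have h2 : ∀ n, 2 ≤ p ^ S n := fun n => by
    have : p ^ 1 ≤ p ^ S n := Nat.pow_le_pow_right hp.pos (hpos (.x n))
    have := hp.two_le
    rw [pow_one] at *
    omega
  have hRp : ∀ n, 1 ≤ p ^ R n := fun n => Nat.pow_pos hp.pos
  induction n with
  | zero =>
    have h := pivots_mem hF hpos hg 0
    have h1 := hF.lie_mem h.1 h.2.2
    rw [← Derivation.commutator_coe_linear_map, lie_v_u hpos] at h1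
    have h3 := lower_x_mem hF hpos hg (n := 0) (L := scale p S R 0 + scale p S R 0)
      (by rwa [show full p S R 0 = 0 from rfl, zero_add])
    refine hF.mono ?_ h3
    have := h2 0
    have := hRp 0
    rw [scale_succ, scale_zero]
    omega
  | succ n ih =>
    set f := mono K p (bound S R) (full p S R n + Finsupp.single (Var.z n) (p ^ R n - 1)) with hf
    have hv := isPivot_v K p S R
    have hu := isPivot_u K p S R
    have hn1 : n < n + 1 := Nat.lt_succ_self n
    have hvn : v K p S R n = partialDer (.x n) +
        pair K p S R (.x n) (.y n) • v K p S R (n + 1) := hv.eq_add n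
    have hvf : v K p S R n f = 0 := by
      rw [hv.apply_eq, hv.eq_zero (n + 1), mul_zero, add_zero]
      · refine partialDer_eq_zero (s := {.x n}ᶜ) (by simp) (mono_mem_subspace fun a ha => ?_)
        rintro rfl
        simp [full_apply, Var.idx] at ha
      · refine mono_mem_subspace fun a ha => ?_
        by_contra h
        rw [Finsupp.add_apply, full_apply, if_neg (fun h' => h (h'.trans hn1))] at ha
        rcases eq_or_ne (Var.z n) a with rfl | h'
        · exact h hn1
        · simp [h'] at ha
    have hlie : ⁅v K p S R n, u K p S R (n + 1)⁆ =
        pair K p S R (.x n) (.y n) • ⁅v K p S R (n + 1), u K p S R (n + 1)⁆ := by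
      rw [hvn, add_lie, hu.lie_partialDer (hn1 : (Var.x n).idx < n + 1), der_smul_lie,
        hu.eq_zero (n + 1) _ (pair_mem_subspace (hn1 : (Var.x n).idx < n + 1)
          (hn1 : (Var.y n).idx < n + 1))]
      simp
    -- v_n kills f, so it acts on u_{n+1} alone and brings in x_n^{top} y_n^{top}, the two factors
    -- that f z-wise already completes to the full box of generation ≤ n.
    have h1 := hF.lie_mem (pivots_mem hF hpos hg n).1 ih
    rw [← Derivation.commutator_coe_linear_map, der_lie_smul, hvf, zero_smul, zero_add, hlie,
      lie_v_u hpos, smul_smul, smul_smul, mul_assoc] at h1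
    have e : f * (pair K p S R (.x n) (.y n) * mono K p (bound S R)
        (Finsupp.single (Var.z (n + 1)) (p ^ R (n + 1) - 1) +
          Finsupp.single (Var.x (n + 1)) (p ^ S (n + 1) - 1 - 1))) =
        mono K p (bound S R) (full p S R (n + 1) +
          (Finsupp.single (Var.z (n + 1)) (p ^ R (n + 1) - 1) +
          Finsupp.single (Var.x (n + 1)) (p ^ S (n + 1) - 1 - 1))) := by
      have e1 : f * pair K p S R (.x n) (.y n) = mono K p (bound S R) (full p S R (n + 1)) := by
        rw [pair, top, top, mono_mul_mono_of_disjoint, mono_mul_mono_of_disjoint, full_succ]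
        · simp only [bound]
          congr 1
          abel
        · intro a
          rw [Finsupp.add_apply, full_apply]
          cases a with
          | x i =>
            rcases eq_or_ne n i with rfl | h
            · left; simp [Var.idx]
            · right; simp [h]
          | y i =>
            rcases eq_or_ne n i with rfl | h
            · left; simp [Var.idx]
            · right; simp [h]
          | z i => right; simp
        · intro a
          rcases eq_or_ne (Var.x n) a with rfl | h
          · right; simp
          · left; simp [h]
      rw [← mul_assoc, e1, mono_mul_mono_of_disjoint]
      intro a
      rw [full_apply]
      by_cases ha : a.idx < n + 1
      · right
        rw [Finsupp.add_apply, single_apply_of_idx_ne ha.ne, single_apply_of_idx_ne ha.ne]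
      · left; rw [if_neg ha]
    rw [e] at h1
    -- With c = `scale (n+1)`, the degree is `scale n` + c + (p^{S_{n+1}} - 2)c ≤ p^{S_{n+1}} c ≤
    -- `scale (n+2)`; the last summand pays for stripping x_{n+1}^{(top - 1)}.
    refine hF.mono ?_ (lower_x_mem hF hpos hg h1)
    have h3 := h2 (n + 1)
    have h4 := hRp (n + 1)
    have h5 : scale p S R n ≤ scale p S R (n + 1) := by
      rw [scale_succ]
      exact Nat.le_mul_of_pos_right _ (by have := h2 n; have := hRp n; omega)
    obtain ⟨a, ha⟩ : ∃ a, p ^ S (n + 1) = a + 2 := ⟨p ^ S (n + 1) - 2, by omega⟩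
    obtain ⟨b, hb⟩ : ∃ b, p ^ R (n + 1) = b + 1 := ⟨p ^ R (n + 1) - 1, by omega⟩
    rw [scale_succ _ _ _ (n + 1), ha, hb, show a + 2 - 1 - 1 = a by omega,
      show a + 2 + (b + 1) - 1 = a + b + 2 by omega]
    nlinarith [Nat.zero_le (b * scale p S R (n + 1))]

/-- The lower bound for the growth with respect to the standard generators. -/
theorem boxCard_le_growth (hpos : ∀ a, 1 ≤ bound S R a) (n : ℕ) :
    boxCard p S R n ≤ growth K p (gens K p S R) (3 * scale p S R (n + 1)) := by
  have hp : p.Prime := Fact.out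
  have hF := isRestrictedFiltration_growthSpace (K := K) p (gens K p S R)
  have hg := subset_growthSpace_one (K := K) (p := p) (gens K p S R)
  have hu := isPivot_u K p S R
  have hfin : FiniteDimensional K
      (growthSpace K p (gens K p S R) (3 * scale p S R (n + 1))) :=
    finiteDimensional_growthSpace p (by simp [gens]) _
  set e := Finsupp.single (Var.z n) (p ^ R n - 1) with he
  have hbd : ∀ r ∈ Finset.Iic (full p S R n), ∀ b, (r + e) b < p ^ bound S R b := by
    intro r hr b
    have h1 := ((le_full_iff p S R).1 (Finset.mem_Iic.1 hr)).1 b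
    have h2 := ((le_full_iff p S R).1 (Finset.mem_Iic.1 hr)).2 b
    have hb := Nat.pow_pos (n := bound S R b) hp.pos
    rcases eq_or_ne (Var.z n) b with rfl | h
    · have : r (.z n) = 0 := by
        by_contra h0
        exact absurd (h2 h0) (lt_irrefl n)
      simp [he, this]
      simp [bound] at hb ⊢
      omega
    · simpa [he, h] using h1
  have hmem : ∀ r ∈ Finset.Iic (full p S R n),
      (mono K p (bound S R) (r + e) • u K p S R (n + 1)).toLinearMap ∈
        growthSpace K p (gens K p S R) (3 * scale p S R (n + 1)) := by
    intro r hr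
    have hr' := Finset.mem_Iic.1 hr
    have e1 : r + e + (full p S R n - r) = full p S R n + e := by
      rw [add_right_comm, add_tsub_cancel_of_le hr']
    -- Stripping the complement of r from the full monomial costs at most 2 · `scale n`, which gives
    -- the factor 3 in the statement.
    have h := lower_all_mem hF hpos hg (n := n + 1) (full p S R n - r) (r + e)
      (L := scale p S R (n + 1)) (fun a ha => ?_) ?_ ?_
    · refine hF.mono ?_ h
      have h1 : wt p S R (full p S R n) ≤ 2 * scale p S R n :=
        wt_full_le p S R (fun i => hpos (.x i)) n
      have h2 : wt p S R (full p S R n - r) ≤ wt p S R (full p S R n) := by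
        conv_rhs => rw [← tsub_add_cancel_of_le hr', map_add]
        exact Nat.le_add_right _ _
      have h3 : scale p S R n ≤ scale p S R (n + 1) := by
        rw [scale_succ]
        refine Nat.le_mul_of_pos_right _ ?_
        have := Nat.pow_pos (n := S n) hp.pos
        have := Nat.pow_pos (n := R n) hp.pos
        omega
      omega
    · refine below_mono (Nat.le_succ n) (((le_full_iff p S R).1 le_rfl).2 a ?_)
      intro h0
      rw [Finsupp.tsub_apply] at ha
      omega
    · rw [e1]
      exact hbd _ (Finset.mem_Iic.2 le_rfl)
    · rw [e1]
      exact full_smul_mem hF hpos hg n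
  let φ : Finset.Iic (full p S R n) → growthSpace K p (gens K p S R) (3 * scale p S R (n + 1)) :=
    fun r => ⟨_, hmem r.1 r.2⟩
  -- u_{n+1} sends z_{n+1} to 1, so evaluation at z_{n+1} returns the coefficient monomials, which
  -- are distinct basis vectors.
  let g : Alg K p S R := mono K p (bound S R) (Finsupp.single (.z (n + 1)) 1)
  have hug : u K p S R (n + 1) g = 1 := by
    rw [hu.apply_eq, hu.eq_zero (n + 2), mul_zero, add_zero]
    · have := partialDer_mono_add (K := K) (p := p) (S := bound S R) (a := .z (n + 1)) (i := 0) ?_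
      · rwa [zero_add] at this
      · intro b
        have hb : p ^ 1 ≤ p ^ bound S R b := Nat.pow_le_pow_right hp.pos (hpos b)
        have := hp.two_le
        rw [pow_one] at hb
        rcases eq_or_ne (Var.z (n + 1)) b with rfl | h
        · simp; omega
        · simp [h]; omega
    · refine mono_mem_subspace fun a ha => ?_
      rcases eq_or_ne (Var.z (n + 1)) a with rfl | h
      · exact Nat.lt_succ_self (n + 1)
      · simp [h] at ha
  let ev : growthSpace K p (gens K p S R) (3 * scale p S R (n + 1)) →ₗ[K] Alg K p S R :=
    (LinearMap.applyₗ g).comp (Submodule.subtype _)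
  have hli : LinearIndependent K φ := by
    refine LinearIndependent.of_comp ev ?_
    have h1 : ev ∘ φ = fun r => basis K p (bound S R) ⟨r.1 + e, hbd r.1 r.2⟩ := by
      funext r
      rw [basis_eq_mono]
      change mono K p (bound S R) (r.1 + e) * u K p S R (n + 1) g = _
      rw [hug, mul_one]
    rw [h1]
    refine (basis K p (bound S R)).linearIndependent.comp _ fun r s h => Subtype.ext ?_
    exact add_right_cancel (congrArg Subtype.val h)
  have := hli.fintype_card_le_finrank
  rwa [Fintype.card_coe, card_Iic_full] at this

end

end Clover

end

/-! ### Upper bound: derivations are determined by their values on the t^{(p^k)} -/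

noncomputable section

namespace Clover

open DivPow

/-- Lucas' theorem strips the lowest digits in base p; what remains modulo p is the leading digit of
k. -/
theorem not_dvd_choose_pow {p : ℕ} [Fact p.Prime] (e : ℕ) {k : ℕ} (h1 : p ^ e ≤ k)
    (h2 : k < p ^ (e + 1)) : ¬p ∣ k.choose (p ^ e) := by
  have hp : p.Prime := Fact.out
  induction e generalizing k with
  | zero =>
    rw [pow_zero, Nat.choose_one_right]
    exact Nat.not_dvd_of_pos_of_lt h1 (by simpa using h2)
  | succ e ih =>
    have h := Choose.choose_modEq_choose_mod_mul_choose_div_nat (n := k) (k := p ^ (e + 1)) (p := p)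
    rw [pow_succ, Nat.mul_mod_left, Nat.choose_zero_right, one_mul,
      Nat.mul_div_cancel _ hp.pos, ← pow_succ] at h
    rw [h.dvd_iff dvd_rfl]
    refine ih ((Nat.le_div_iff_mul_le hp.pos).2 ?_) ((Nat.div_lt_iff_lt_mul hp.pos).2 ?_)
    · rwa [← pow_succ]
    · rwa [← pow_succ]

section Der

variable (K : Type*) [Field K] (A : Type*) [CommRing A] [Algebra K A]

/-- The space of derivations, as a subspace of the endomorphisms. -/
def derSubmodule : Submodule K (Module.End K A) where
  carrier := {D | ∀ f, ⁅D, LinearMap.mulLeft K f⁆ = LinearMap.mulLeft K (D f)}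
  zero_mem' f := by rw [ring_zero_lie]; ext; simp
  add_mem' {D E} hD hE f := by
    rw [ring_add_lie, hD f, hE f]
    ext; simp [add_mul]
  smul_mem' c D hD f := (ring_smul_lie c D _).trans (by rw [hD f]; ext; simp)

variable {K A}

theorem derSubmodule_leibniz {D : Module.End K A} (hD : D ∈ derSubmodule K A) (f g : A) :
    D (f * g) = f * D g + g * D f := by
  have h := LinearMap.congr_fun (hD f) g
  simp only [Ring.lie_def, LinearMap.sub_apply, Module.End.mul_apply,
    LinearMap.mulLeft_apply] at h
  rw [sub_eq_iff_eq_add] at h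
  rw [h]; ring

theorem toLinearMap_mem_derSubmodule (D : Derivation K A A) :
    D.toLinearMap ∈ derSubmodule K A := by
  intro f
  ext g
  simp only [Ring.lie_def, LinearMap.sub_apply, Module.End.mul_apply, LinearMap.mulLeft_apply,
    Derivation.coeFn_coe, Derivation.leibniz, smul_eq_mul]
  ring

theorem lie_mem_derSubmodule {D E : Module.End K A} (hD : D ∈ derSubmodule K A)
    (hE : E ∈ derSubmodule K A) : ⁅D, E⁆ ∈ derSubmodule K A := by
  intro f
  rw [ring_lie_lie, hE f, hD f, hE (D f), hD (E f)]
  ext g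
  simp [Ring.lie_def, sub_mul]

/-- With the Leibniz rule stated as a commutator with multiplication operators, this is ad(D^p) =
ad(D)^p. -/
theorem pow_mem_derSubmodule (p : ℕ) [Fact p.Prime] [CharP K p] {D : Module.End K A}
    (hD : D ∈ derSubmodule K A) : D ^ p ∈ derSubmodule K A := by
  intro f
  have h := lie_pow_char_pow (K := K) p D (LinearMap.mulLeft K f) 1
  rw [pow_one] at h
  rw [h]
  have key : ∀ n, (adHom K D ^ n) (LinearMap.mulLeft K f) = LinearMap.mulLeft K ((D ^ n) f) := by
    intro n
    induction n with
    | zero => rfl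
    | succ n ih =>
      rw [pow_succ', Module.End.mul_apply, ih, adHom_apply, hD, pow_succ', Module.End.mul_apply]
  exact key p

end Der

section

variable {Θ : Type*} {K : Type*} [Field K] {p : ℕ} {S : Θ → ℕ} [Fact p.Prime] [CharP K p]

/-- If p^e is the leading power of p in k, then t^{(k)} is a unit multiple of t^{(p^e)} t^{(k -
p^e)}. Hence the t^{(p^e)} generate the divided powers of t. -/
theorem derSubmodule_mono_single_eq_zero {D : Module.End K (DivPow K p S)}
    (hD : D ∈ derSubmodule K (DivPow K p S)) {a : Θ}
    (h : ∀ k < S a, D (mono K p S (Finsupp.single a (p ^ k))) = 0) (k : ℕ) (hk : k < p ^ S a) :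
    D (mono K p S (Finsupp.single a k)) = 0 := by
  have hp : p.Prime := Fact.out
  induction k using Nat.strong_induction_on with
  | _ k ih =>
    rcases Nat.eq_zero_or_pos k with rfl | hk0
    · have := derSubmodule_leibniz hD 1 1
      rw [mul_one, one_mul, left_eq_add] at this
      rwa [Finsupp.single_zero, ← one_def]
    · set e := Nat.log p k with he
      have h1 : p ^ e ≤ k := Nat.pow_log_le_self p hk0.ne'
      have h2 : k < p ^ (e + 1) := Nat.lt_pow_succ_log_self hp.one_lt k
      have he' : e < S a := (Nat.pow_lt_pow_iff_right hp.one_lt).1 (h1.trans_lt hk)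
      have h3 := Nat.pow_pos (n := e) hp.pos
      have hm : mono K p S (Finsupp.single a (p ^ e)) * mono K p S (Finsupp.single a (k - p ^ e)) =
          ((k.choose (p ^ e) : ℕ) : K) • mono K p S (Finsupp.single a k) := by
        rw [mono_mul_mono, ← Finsupp.single_add, Nat.add_sub_cancel' h1]
        congr 2
        rw [binom, Finsupp.prod_single_index (by simp), Finsupp.single_eq_same,
          Nat.add_sub_cancel' h1]
      have h4 := derSubmodule_leibniz hD (mono K p S (Finsupp.single a (p ^ e)))
        (mono K p S (Finsupp.single a (k - p ^ e)))
      rw [hm, h e he', ih (k - p ^ e) (by omega) (by omega), map_smul, mul_zero, mul_zero,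
        add_zero] at h4
      refine (smul_eq_zero.1 h4).resolve_left ?_
      rw [CharP.cast_eq_zero_iff K p]
      exact not_dvd_choose_pow e h1 h2

theorem derSubmodule_eq_zero {D : Module.End K (DivPow K p S)}
    (hD : D ∈ derSubmodule K (DivPow K p S)) {s : Set Θ}
    (h : ∀ a ∈ s, ∀ k < S a, D (mono K p S (Finsupp.single a (p ^ k))) = 0)
    {f : DivPow K p S} (hf : f ∈ subspace K p S s) : D f = 0 := by
  induction hf using subspace_induction with
  | zero => simp
  | add f₁ f₂ _ _ h₁ h₂ => rw [map_add, h₁, h₂, add_zero]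
  | smul c f _ h => rw [map_smul, h, smul_zero]
  | mono i hi =>
    obtain ⟨i, hib⟩ := i
    simp only at hi ⊢
    induction i using Finsupp.induction with
    | zero =>
      have := derSubmodule_leibniz hD 1 1
      rw [mul_one, one_mul, left_eq_add] at this
      rwa [← one_def]
    | single_add a k i ha hk ih =>
      have ha0 : i a = 0 := Finsupp.notMem_support_iff.1 ha
      have hs : a ∈ s := hi a (by simp [ha0, hk])
      have hka : k < p ^ S a := by have := hib a; simpa [ha0] using this
      have hi' : ∀ b, i b < p ^ S b := fun b => lt_of_le_of_lt (by simp) (hib b)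
      have hi2 : ∀ b, i b ≠ 0 → b ∈ s := fun b hb => hi b (by
        rw [Finsupp.add_apply]; omega)
      have hm : mono K p S (Finsupp.single a k) * mono K p S i =
          mono K p S (Finsupp.single a k + i) := by
        refine mono_mul_mono_of_disjoint fun b => ?_
        rcases eq_or_ne a b with rfl | hb
        · right; exact ha0
        · left; simp [hb]
      rw [← hm, derSubmodule_leibniz hD, ih hi' hi2,
        derSubmodule_mono_single_eq_zero hD (h a hs) k hka]
      simp

end

/-! ### Operators filtered by how far they lower weights -/

section

variable {K : Type*} [Field K] {p : ℕ} {S R : ℕ → ℕ}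

theorem linearMap_ext_above_below {n : ℕ} {M : Type*} [AddCommGroup M] [Module K M]
    {A B : Alg K p S R →ₗ[K] M}
    (h : ∀ f ∈ subspace K p (bound S R) (above n), ∀ r ∈ subspace K p (bound S R) (below n),
      A (f * r) = B (f * r)) : A = B := by
  classical
  refine LinearMap.ext fun g => ?_
  induction g using mono_induction with
  | zero => simp
  | add f₁ f₂ h₁ h₂ => simp only [map_add, h₁, h₂]
  | smul c f h => simp only [map_smul, h]
  | mono i =>
    have e : mono K p (bound S R) i.1 =
        mono K p (bound S R) (i.1.filter fun a => a ∈ above n) *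
          mono K p (bound S R) (i.1.filter fun a => ¬a ∈ above n) := by
      rw [mono_mul_mono_of_disjoint, Finsupp.filter_add_filter_not]
      intro a
      by_cases ha : a ∈ above n
      · right; simp [ha]
      · left; simp [ha]
    rw [e]
    refine h _ (mono_mem_subspace fun a ha => ?_) _ (mono_mem_subspace fun a ha => ?_)
    · by_contra h'; simp [h'] at ha
    · by_contra h'
      have : a ∈ above n := not_lt.1 (show ¬a.idx < n from h')
      simp [this] at ha

variable (K p S R) in
/-- The span of the monomials in the variables of generation less than `n` that have weight at
least `e`. -/
def weighted (n : ℕ) (e : ℤ) : Submodule K (Alg K p S R) :=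
  Submodule.span K {f | ∃ i : Var →₀ ℕ, i ≤ full p S R n ∧ e ≤ (wt p S R i : ℤ) ∧
    f = mono K p (bound S R) i}

theorem weighted_eq_bot {n : ℕ} {e : ℤ} (h : (wt p S R (full p S R n) : ℤ) < e) :
    weighted K p S R n e = ⊥ := by
  rw [weighted, Submodule.span_eq_bot]
  rintro f ⟨i, h1, h2, -⟩
  have : wt p S R i ≤ wt p S R (full p S R n) := by
    conv_rhs => rw [← tsub_add_cancel_of_le h1, map_add]
    exact Nat.le_add_left _ _
  omega

variable (K p S R) in
/-- The operators that are linear over the divided powers of the variables of generation at least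
`n` and lower the weight of the monomials in the other variables by at most `t`. -/
def lowering (n : ℕ) (t : ℤ) : Submodule K (Module.End K (Alg K p S R)) where
  carrier := {E | (∀ f ∈ subspace K p (bound S R) (above n), ∀ g, E (f * g) = f * E g) ∧
    ∀ e, ∀ r ∈ weighted K p S R n e, E r ∈ weighted K p S R n (e - t)}
  zero_mem' := ⟨fun _ _ _ => by simp, fun _ _ _ => zero_mem _⟩
  add_mem' := fun hA hB => ⟨fun f hf g => by
    rw [LinearMap.add_apply, hA.1 f hf, hB.1 f hf, LinearMap.add_apply, mul_add],
    fun e r hr => add_mem (hA.2 e r hr) (hB.2 e r hr)⟩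
  smul_mem' := fun c A hA => ⟨fun f hf g => by
    rw [LinearMap.smul_apply, hA.1 f hf, LinearMap.smul_apply, mul_smul_comm],
    fun e r hr => Submodule.smul_mem _ _ (hA.2 e r hr)⟩

theorem lowering_mono (n : ℕ) {s t : ℤ} (h : s ≤ t) : lowering K p S R n s ≤ lowering K p S R n t :=
  fun A hA => ⟨hA.1, fun e r hr => by
    have h1 : weighted K p S R n (e - s) ≤ weighted K p S R n (e - t) :=
      Submodule.span_mono fun f ⟨i, h1, h2, h3⟩ => ⟨i, h1, by omega, h3⟩
    exact h1 (hA.2 e r hr)⟩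

theorem one_mem_lowering (n : ℕ) : (1 : Module.End K (Alg K p S R)) ∈ lowering K p S R n 0 :=
  ⟨fun _ _ _ => rfl, fun e r hr => by simpa using hr⟩

theorem mul_mem_lowering {n : ℕ} {s t : ℤ} {A B : Module.End K (Alg K p S R)}
    (hA : A ∈ lowering K p S R n s) (hB : B ∈ lowering K p S R n t) :
    A * B ∈ lowering K p S R n (s + t) := by
  refine ⟨fun f hf g => ?_, fun e r hr => ?_⟩
  · rw [Module.End.mul_apply, hB.1 f hf, hA.1 f hf, Module.End.mul_apply]
  · have := hA.2 _ _ (hB.2 e r hr)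
    rwa [sub_sub, add_comm t s] at this

theorem lowering_eq_zero_of_below {n : ℕ} {t : ℤ} {A : Module.End K (Alg K p S R)}
    (hA : A ∈ lowering K p S R n t) (h : ∀ r ∈ subspace K p (bound S R) (below n), A r = 0) :
    A = 0 :=
  linearMap_ext_above_below fun f hf r hr => by
    rw [hA.1 f hf, h r hr, mul_zero, LinearMap.zero_apply]

variable [Fact p.Prime]

theorem subspace_below_eq (n : ℕ) : subspace K p (bound S R) (below n) =
    Submodule.span K {f | ∃ i : Var →₀ ℕ, i ≤ full p S R n ∧ f = mono K p (bound S R) i} := by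
  unfold subspace
  congr 1
  ext f
  constructor
  · rintro ⟨i, hi, rfl⟩
    exact ⟨i.1, (le_full_iff p S R).2 ⟨i.2, hi⟩, rfl⟩
  · rintro ⟨i, hi, rfl⟩
    obtain ⟨h1, h2⟩ := (le_full_iff p S R).1 hi
    exact ⟨⟨i, h1⟩, h2, rfl⟩

theorem subspace_below_le_weighted (n : ℕ) :
    subspace K p (bound S R) (below n) ≤ weighted K p S R n 0 := by
  rw [subspace_below_eq]
  exact Submodule.span_mono fun f ⟨i, h1, h2⟩ => ⟨i, h1, by positivity, h2⟩

theorem weighted_le_subspace_below (n : ℕ) (e : ℤ) :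
    weighted K p S R n e ≤ subspace K p (bound S R) (below n) := by
  rw [subspace_below_eq]
  exact Submodule.span_mono fun f ⟨i, h1, _, h2⟩ => ⟨i, h1, h2⟩

theorem finrank_subspace_below (n : ℕ) :
    FiniteDimensional K (subspace K p (bound S R) (below n)) ∧
    Module.finrank K (subspace K p (bound S R) (below n)) ≤ boxCard p S R n := by
  classical
  have e : subspace K p (bound S R) (below n) = Submodule.span K
      (((Finset.Iic (full p S R n)).image (mono K p (bound S R)) : Finset (Alg K p S R)) :
        Set (Alg K p S R)) := by
    rw [subspace_below_eq]
    congr 1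
    ext f
    simp [eq_comm]
  rw [e]
  refine ⟨FiniteDimensional.span_finset K _, (finrank_span_finset_le_card _).trans ?_⟩
  exact Finset.card_image_le.trans (card_Iic_full p S R n).le

theorem weighted_mono {m n : ℕ} {d e : ℤ} (hmn : m ≤ n) (hde : d ≤ e) :
    weighted K p S R m e ≤ weighted K p S R n d := by
  refine Submodule.span_mono fun f ⟨i, h1, h2, h3⟩ => ⟨i, ?_, hde.trans h2, h3⟩
  rw [le_full_iff] at h1 ⊢
  exact ⟨h1.1, fun a ha => below_mono hmn (h1.2 a ha)⟩

theorem mono_mem_weighted {n : ℕ} {e : ℤ} {i : Var →₀ ℕ} (h : ∀ a, i a ≠ 0 → a ∈ below n)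
    (he : e ≤ wt p S R i) : mono K p (bound S R) i ∈ weighted K p S R n e := by
  by_cases hi : ∀ a, i a < p ^ bound S R a
  · exact Submodule.subset_span ⟨i, (le_full_iff p S R).2 ⟨hi, h⟩, he, rfl⟩
  · rw [mono, dif_neg hi]
    exact zero_mem _

theorem mul_mem_weighted {n : ℕ} {d e : ℤ} {f g : Alg K p S R}
    (hf : f ∈ weighted K p S R n d) (hg : g ∈ weighted K p S R n e) :
    f * g ∈ weighted K p S R n (d + e) := by
  induction hf using Submodule.span_induction with
  | zero => simp
  | add f₁ f₂ _ _ h₁ h₂ => rw [add_mul]; exact add_mem h₁ h₂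
  | smul c f _ h => rw [smul_mul_assoc]; exact Submodule.smul_mem _ _ h
  | mem f hf =>
  induction hg using Submodule.span_induction with
  | zero => simp
  | add f₁ f₂ _ _ h₁ h₂ => rw [mul_add]; exact add_mem h₁ h₂
  | smul c f _ h => rw [mul_smul_comm]; exact Submodule.smul_mem _ _ h
  | mem g hg =>
  obtain ⟨i, hi, hi', rfl⟩ := hf
  obtain ⟨j, hj, hj', rfl⟩ := hg
  rw [mono_mul_mono]
  refine Submodule.smul_mem _ _ (mono_mem_weighted (fun a ha => ?_) ?_)
  · by_cases h : i a = 0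
    · exact ((le_full_iff p S R).1 hj).2 a fun h' => ha (by simp [h, h'])
    · exact ((le_full_iff p S R).1 hi).2 a h
  · rw [map_add]; push_cast; omega

/-- Negative t means raising weights by at least -t; here every monomial would be pushed past the
largest weight available. -/
theorem lowering_eq_zero {n : ℕ} {t : ℤ} (ht : t < -(wt p S R (full p S R n) : ℤ))
    {A : Module.End K (Alg K p S R)} (hA : A ∈ lowering K p S R n t) : A = 0 := by
  refine lowering_eq_zero_of_below hA fun r hr => ?_
  have := hA.2 0 r (subspace_below_le_weighted n hr)
  rwa [weighted_eq_bot (by omega), Submodule.mem_bot] at this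

theorem mulLeft_mem_lowering {n : ℕ} {e : ℤ} {q : Alg K p S R} (hq : q ∈ weighted K p S R n e) :
    LinearMap.mulLeft K q ∈ lowering K p S R n (-e) := by
  refine ⟨fun f _ g => ?_, fun d r hr => ?_⟩
  · simp only [LinearMap.mulLeft_apply]; ring
  · have := mul_mem_weighted hq hr
    rwa [add_comm, ← sub_neg_eq_add] at this

theorem lowering_below {n : ℕ} {t : ℤ} {A : Module.End K (Alg K p S R)}
    (hA : A ∈ lowering K p S R n t) {r : Alg K p S R}
    (hr : r ∈ subspace K p (bound S R) (below n)) : A r ∈ subspace K p (bound S R) (below n) :=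
  weighted_le_subspace_below _ _ (hA.2 0 r (subspace_below_le_weighted n hr))

variable [CharP K p]

theorem partialDer_mem_lowering {n : ℕ} {a : Var} (ha : a ∈ below n) :
    (partialDer a : Derivation K (Alg K p S R) _).toLinearMap ∈
      lowering K p S R n (scale p S R a.idx) := by
  refine ⟨fun f hf g => ?_, fun e r hr => ?_⟩
  · change (partialDer a : Derivation K (Alg K p S R) _) (f * g) = f * partialDer a g
    rw [Derivation.leibniz, partialDer_eq_zero (s := above n) (fun h => absurd (show a.idx < n from ha) (not_lt.2 h)) hf]
    simp
  · induction hr using Submodule.span_induction with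
    | zero => simp
    | add f₁ f₂ _ _ h₁ h₂ => rw [map_add]; exact add_mem h₁ h₂
    | smul c f _ h => rw [map_smul]; exact Submodule.smul_mem _ _ h
    | mem f hf =>
      obtain ⟨i, hi, hi', rfl⟩ := hf
      obtain ⟨h1, h2⟩ := (le_full_iff p S R).1 hi
      change partialDer a _ ∈ _
      rw [partialDer_mono a h1]
      split_ifs with h
      · exact zero_mem _
      · refine mono_mem_weighted (fun b hb => h2 b fun h' => hb (by simp [h'])) ?_
        have h3 : Finsupp.single a 1 ≤ i := by
          rw [Finsupp.single_le_iff]; omega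
        have h4 : wt p S R i = wt p S R (i - Finsupp.single a 1) + scale p S R a.idx := by
          conv_lhs => rw [← tsub_add_cancel_of_le h3, map_add, wt_single, one_mul]
        omega

variable {α β : ℕ → Var} {D : ℕ → Derivation K (Alg K p S R) (Alg K p S R)}

/-- D_n differentiates only generations at least n and A acts only on generations below n, each
being linear over the other's variables. -/
theorem IsPivot.comm_lowering (hD : IsPivot α β D) {n : ℕ} {t : ℤ}
    {A : Module.End K (Alg K p S R)} (hA : A ∈ lowering K p S R n t) :
    (D n).toLinearMap * A = A * (D n).toLinearMap := by
  refine linearMap_ext_above_below (n := n) fun f hf r hr => ?_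
  change D n (A (f * r)) = A (D n (f * r))
  rw [hA.1 f hf, Derivation.leibniz, Derivation.leibniz, hD.eq_zero n r hr,
    hD.eq_zero n _ (lowering_below hA hr)]
  simp only [smul_eq_mul, mul_zero, zero_add]
  rw [mul_comm r, hA.1 _ (hD.mem_above le_rfl hf), mul_comm]

/-- Unrolling the recursion m times gives q = ∏_{k<m} α_k^{top} β_k^{top}. Its weight ∑_{k<m}
(p^{S_k} + p^{R_k} - 2) `scale k` telescopes to `scale m` - 1, so each intermediate term q ∂_{α_m}
lowers weights by at most 1. -/
theorem IsPivot.exists_decomposition (hD : IsPivot α β D)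
    (hb : ∀ i, p ^ bound S R (α i) + p ^ bound S R (β i) = p ^ S i + p ^ R i) (n : ℕ) {m : ℕ}
    (hm : m ≤ n) :
    ∃ E ∈ lowering K p S R n 1, ∃ q ∈ weighted K p S R m (scale p S R m - 1),
      (D 0).toLinearMap = E + LinearMap.mulLeft K q * (D m).toLinearMap := by
  have hp : p.Prime := Fact.out
  induction m with
  | zero =>
    refine ⟨0, zero_mem _, 1, ?_, ?_⟩
    · rw [one_def]
      refine mono_mem_weighted (fun a ha => absurd rfl ha) ?_
      simp [scale_zero]
    · ext; simp
  | succ m ih =>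
    obtain ⟨E, hE, q, hq, h⟩ := ih (by omega)
    have hαm : (α m).idx < m + 1 := (hD.idx_left m).trans_lt (Nat.lt_succ_self m)
    have hβm : (β m).idx < m + 1 := (hD.idx_right m).trans_lt (Nat.lt_succ_self m)
    refine ⟨E + LinearMap.mulLeft K q *
      (partialDer (α m) : Derivation K (Alg K p S R) _).toLinearMap, add_mem hE ?_,
      q * pair K p S R (α m) (β m), ?_, ?_⟩
    · have h1 := mul_mem_lowering
        (mulLeft_mem_lowering (weighted_mono (n := n) (by omega) le_rfl hq))
        (partialDer_mem_lowering (K := K) (p := p) (S := S) (R := R) (n := n)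
          (hαm.trans_le hm : α m ∈ below n))
      rwa [hD.idx_left, show ∀ c : ℤ, -(c - 1) + c = 1 by intros; ring] at h1
    · have h1 : ∀ c : Var, c.idx = m → top K p S R c ∈ weighted K p S R (m + 1)
          (((p ^ bound S R c - 1 : ℕ) : ℤ) * scale p S R m) := by
        intro c hc
        refine mono_mem_weighted (fun a ha => ?_) ?_
        · rcases eq_or_ne c a with rfl | h'
          · exact hc.trans_lt (Nat.lt_succ_self m)
          · simp [h'] at ha
        · rw [wt_single, hc]; push_cast; exact le_rfl
      have h2 := mul_mem_weighted (weighted_mono (Nat.le_succ m) le_rfl hq)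
        (mul_mem_weighted (h1 _ (hD.idx_left m)) (h1 _ (hD.idx_right m)))
      have h3 := hb m
      have h4 := Nat.pow_pos (n := bound S R (α m)) hp.pos
      have h5 := Nat.pow_pos (n := bound S R (β m)) hp.pos
      have h6 : p ^ S m + p ^ R m - 1 =
          (p ^ bound S R (α m) - 1) + (p ^ bound S R (β m) - 1) + 1 := by omega
      rw [scale_succ, h6]
      have h7 : ∀ a b c : ℤ, c - 1 + (a * c + b * c) = c * (a + b + 1) - 1 := by intros; ring
      rw [h7] at h2
      push_cast at h2 ⊢
      exact h2
    · rw [h, hD.eq_add m]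
      ext f
      simp only [LinearMap.add_apply, Module.End.mul_apply, LinearMap.mulLeft_apply,
        Derivation.coeFn_coe, Derivation.add_apply, Derivation.smul_apply, smul_eq_mul, pair]
      ring

end

/-! ### Short words are affine in the pivots; the dimension count -/

section

variable {K : Type*} [Field K] {p : ℕ} {S R : ℕ → ℕ} {ι : Type*} [Fintype ι]

variable (K p S R) in
/-- The operators of the form `E + ∑_j E_j D_j`, where `E` lowers the weight by at most `s` and the
`E_j` lower it by at most `s - scale n`. -/
def affineSpace (D : ι → Module.End K (Alg K p S R)) (n : ℕ) (s : ℤ) :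
    Submodule K (Module.End K (Alg K p S R)) where
  carrier := {A | ∃ E ∈ lowering K p S R n s, ∃ E' : ι → Module.End K (Alg K p S R),
    (∀ j, E' j ∈ lowering K p S R n (s - scale p S R n)) ∧ A = E + ∑ j, E' j * D j}
  zero_mem' := ⟨0, zero_mem _, 0, fun _ => zero_mem _, by simp⟩
  add_mem' := by
    rintro _ _ ⟨E, hE, E', hE', rfl⟩ ⟨F, hF, F', hF', rfl⟩
    refine ⟨E + F, add_mem hE hF, E' + F', fun j => add_mem (hE' j) (hF' j), ?_⟩
    simp only [Pi.add_apply, add_mul, Finset.sum_add_distrib]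
    abel
  smul_mem' := by
    rintro c _ ⟨E, hE, E', hE', rfl⟩
    refine ⟨c • E, Submodule.smul_mem _ _ hE, c • E', fun j => Submodule.smul_mem _ _ (hE' j), ?_⟩
    simp only [Pi.smul_apply, smul_mul_assoc, smul_add, Finset.smul_sum]

theorem affineSpace_mono (D : ι → Module.End K (Alg K p S R)) (n : ℕ) {s t : ℤ} (h : s ≤ t) :
    affineSpace K p S R D n s ≤ affineSpace K p S R D n t := by
  rintro _ ⟨E, hE, E', hE', rfl⟩
  exact ⟨E, lowering_mono n h hE, E', fun j => lowering_mono n (by omega) (hE' j), rfl⟩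

variable [Fact p.Prime] [CharP K p]

/-- Multiply by D_j(0) = B + q D_j(n). Pivots of generation n commute past the coefficients, so the
only quadratic terms are q E'_k D_j(n) D_k(n). Here q E'_k lowers weights by at most s + 1 - 2 ·
`scale n`, which `hs` places below minus the largest weight, so it is zero. -/
theorem mul_mem_affineSpace {α β : ι → ℕ → Var}
    {D : ι → ℕ → Derivation K (Alg K p S R) (Alg K p S R)}
    (hD : ∀ j, IsPivot (α j) (β j) (D j))
    (hb : ∀ j i, p ^ bound S R (α j i) + p ^ bound S R (β j i) = p ^ S i + p ^ R i) {n : ℕ} {s : ℤ}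
    (hs : s + 1 + wt p S R (full p S R n) < 2 * scale p S R n) (j : ι)
    {A : Module.End K (Alg K p S R)}
    (hA : A ∈ affineSpace K p S R (fun j => (D j n).toLinearMap) n s) :
    (D j 0).toLinearMap * A ∈ affineSpace K p S R (fun j => (D j n).toLinearMap) n (s + 1) := by
  classical
  obtain ⟨E, hE, E', hE', rfl⟩ := hA
  obtain ⟨B, hB, q, hq, h⟩ := (hD j).exists_decomposition (hb j) n le_rfl
  have hq' := mulLeft_mem_lowering hq
  have h0 : ∀ k, LinearMap.mulLeft K q * E' k = 0 := fun k =>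
    lowering_eq_zero (n := n) (by omega) (mul_mem_lowering hq' (hE' k))
  refine ⟨B * E, ?_, fun k => B * E' k + if k = j then LinearMap.mulLeft K q * E else 0,
    fun k => add_mem ?_ ?_, ?_⟩
  · have := mul_mem_lowering hB hE
    rwa [add_comm] at this
  · have := mul_mem_lowering hB (hE' k)
    rwa [show (1 : ℤ) + (s - scale p S R n) = s + 1 - scale p S R n by ring] at this
  · split_ifs
    · have := mul_mem_lowering hq' hE
      rwa [show -((scale p S R n : ℤ) - 1) + s = s + 1 - scale p S R n by ring] at this
    · exact zero_mem _
  · have h1 : LinearMap.mulLeft K q * ((D j n).toLinearMap * ∑ k, E' k * (D k n).toLinearMap) =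
        0 := by
      rw [Finset.mul_sum, Finset.mul_sum]
      refine Finset.sum_eq_zero fun k _ => ?_
      rw [← mul_assoc (D j n).toLinearMap, (hD j).comm_lowering (hE' k), mul_assoc (E' k),
        ← mul_assoc, h0, zero_mul]
    rw [h, add_mul, mul_add, mul_add, mul_assoc (LinearMap.mulLeft K q), mul_assoc
      (LinearMap.mulLeft K q), h1, add_zero, (hD j).comm_lowering hE]
    simp only [add_mul, Finset.sum_add_distrib, ite_mul, zero_mul, Finset.sum_ite_eq',
      Finset.mem_univ, if_true, Finset.mul_sum, mul_assoc, add_assoc]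

theorem pow_span_le_affineSpace {α β : ι → ℕ → Var}
    {D : ι → ℕ → Derivation K (Alg K p S R) (Alg K p S R)}
    (hD : ∀ j, IsPivot (α j) (β j) (D j))
    (hb : ∀ j i, p ^ bound S R (α j i) + p ^ bound S R (β j i) = p ^ S i + p ^ R i) {n : ℕ} (s : ℕ)
    (hs : s + wt p S R (full p S R n) < 2 * scale p S R n) :
    Submodule.span K (Set.range fun j => (D j 0).toLinearMap) ^ s ≤
      affineSpace K p S R (fun j => (D j n).toLinearMap) n s := by
  induction s with
  | zero =>
    rw [pow_zero, Submodule.one_le]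
    exact ⟨1, one_mem_lowering n, 0, fun _ => zero_mem _, by simp⟩
  | succ s ih =>
    rw [pow_succ', Submodule.mul_le]
    intro x hx y hy
    have hy' := ih (by omega) hy
    induction hx using Submodule.span_induction with
    | mem x hx =>
      obtain ⟨j, rfl⟩ := hx
      push_cast
      exact mul_mem_affineSpace hD hb (by exact_mod_cast hs) j hy'
    | zero => rw [zero_mul]; exact zero_mem _
    | add a b _ _ ha hb => rw [add_mul]; exact add_mem ha hb
    | smul c a _ ha => rw [smul_mul_assoc]; exact Submodule.smul_mem _ _ ha

/-- On generations below n the pivots vanish, so the values there recover E. On r · α_k(n), with r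
of generation below n, only the k-th pivot contributes, and the value is E'_k r. -/
theorem affineSpace_eq_zero {α β : ι → ℕ → Var}
    {D : ι → ℕ → Derivation K (Alg K p S R) (Alg K p S R)}
    (hD : ∀ j, IsPivot (α j) (β j) (D j)) (hpos : ∀ a, 1 ≤ bound S R a) {n : ℕ} {s : ℤ}
    (hα : Function.Injective fun j => α j n) {A : Module.End K (Alg K p S R)}
    (hA : A ∈ affineSpace K p S R (fun j => (D j n).toLinearMap) n s)
    (hder : A ∈ derSubmodule K (Alg K p S R))
    (h : ∀ f ∈ subspace K p (bound S R) (below (n + 1)), A f = 0) : A = 0 := by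
  classical
  have hp : p.Prime := Fact.out
  obtain ⟨E, hE, E', hE', rfl⟩ := hA
  have hE0 : E = 0 := by
    refine lowering_eq_zero_of_below hE fun r hr => ?_
    have h1 := h r (subspace_mono (below_mono (Nat.le_succ n)) hr)
    rw [LinearMap.add_apply, LinearMap.sum_apply, Finset.sum_eq_zero, add_zero] at h1
    · exact h1
    · intro j _
      rw [Module.End.mul_apply, Derivation.coeFn_coe, (hD j).eq_zero n r hr, map_zero]
  subst hE0
  have hE'0 : ∀ k, E' k = 0 := by
    intro k
    refine lowering_eq_zero_of_below (hE' k) fun r hr => ?_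
    set t : Alg K p S R := mono K p (bound S R) (Finsupp.single (α k n) 1) with ht
    have htn : t ∈ subspace K p (bound S R) (below (n + 1)) :=
      mono_mem_subspace fun a ha => by
        rcases eq_or_ne (α k n) a with rfl | h'
        · exact ((hD k).idx_left n).trans_lt (Nat.lt_succ_self n)
        · simp [h'] at ha
    have hbd : ∀ b, (0 + Finsupp.single (α k n) 1 : Var →₀ ℕ) b < p ^ bound S R b := by
      intro b
      have hb : p ^ 1 ≤ p ^ bound S R b := Nat.pow_le_pow_right hp.pos (hpos b)
      have := hp.two_le
      rw [pow_one] at hb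
      rcases eq_or_ne (α k n) b with rfl | h'
      · simp; omega
      · simp [h']; omega
    have hDt : ∀ j, D j n t = if j = k then 1 else 0 := by
      intro j
      rw [(hD j).apply_eq, (hD j).eq_zero (n + 1) t htn, mul_zero, add_zero]
      split_ifs with hjk
      · subst hjk
        have := partialDer_mono_add (K := K) hbd
        rwa [zero_add] at this
      · exact partialDer_eq_zero (s := {α k n}) (fun h' => hjk (hα h'))
          (mono_mem_subspace fun a ha => by
            by_contra h'
            exact ha (Finsupp.single_eq_of_ne h'))
    have h1 := h (r * t) (mul_mem_subspace (subspace_mono (below_mono (Nat.le_succ n)) hr) htn)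
    rw [zero_add, LinearMap.sum_apply, Finset.sum_eq_single k] at h1
    · rwa [Module.End.mul_apply, Derivation.coeFn_coe, Derivation.leibniz, (hD k).eq_zero n r hr,
        hDt, if_pos rfl, smul_zero, add_zero, smul_eq_mul, mul_one] at h1
    · intro j _ hj
      rw [Module.End.mul_apply, Derivation.coeFn_coe, Derivation.leibniz, (hD j).eq_zero n r hr,
        hDt, if_neg hj, smul_zero, smul_zero, add_zero, map_zero]
    · simp
  simp [hE'0]

theorem rightNormed_mem_pow {A : Type*} [Ring A] [Algebra K A] {X : Set A} {l : List A}
    (h : l ≠ []) (hl : ∀ x ∈ l, x ∈ X) : rightNormed l ∈ Submodule.span K X ^ l.length := by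
  induction l with
  | nil => exact absurd rfl h
  | cons x l ih =>
    have hx : x ∈ Submodule.span K X := Submodule.subset_span (hl x (by simp))
    cases l with
    | nil => simpa [rightNormed] using hx
    | cons y l =>
      have hy := ih (by simp) fun z hz => hl z (by simp [hz])
      rw [rightNormed, Ring.lie_def]
      refine sub_mem ?_ ?_
      · rw [List.length_cons, pow_succ']
        exact Submodule.mul_mem_mul hx hy
      · rw [List.length_cons, pow_succ]
        exact Submodule.mul_mem_mul hy hx

variable (K p S R) in
/-- The derivations that preserve, for all `n`, the divided powers of the variables of generation
less than `n`. -/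
def triangular : Submodule K (Module.End K (Alg K p S R)) where
  carrier := {A | A ∈ derSubmodule K (Alg K p S R) ∧
    ∀ n, ∀ f ∈ subspace K p (bound S R) (below n), A f ∈ subspace K p (bound S R) (below n)}
  zero_mem' := ⟨zero_mem _, fun _ _ _ => zero_mem _⟩
  add_mem' := fun hA hB => ⟨add_mem hA.1 hB.1, fun n f hf => add_mem (hA.2 n f hf) (hB.2 n f hf)⟩
  smul_mem' := fun _ _ hA => ⟨Submodule.smul_mem _ _ hA.1,
    fun n f hf => Submodule.smul_mem _ _ (hA.2 n f hf)⟩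

theorem isRestrictedFiltration_triangular :
    IsRestrictedFiltration p fun _ => triangular K p S R where
  mono _ _ _ := le_rfl
  lie_mem ha hb := ⟨lie_mem_derSubmodule ha.1 hb.1, fun n f hf =>
    sub_mem (ha.2 n _ (hb.2 n f hf)) (hb.2 n _ (ha.2 n f hf))⟩
  pow_mem {m a} ha := ⟨pow_mem_derSubmodule p ha.1, fun n f hf => by
    have key : ∀ k, (a ^ k) f ∈ subspace K p (bound S R) (below n) := by
      intro k
      induction k with
      | zero => exact hf
      | succ k ih => rw [pow_succ', Module.End.mul_apply]; exact ha.2 n _ ih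
    exact key p⟩

/-- Successive boxes grow by a factor of at least 2, so the last one dominates the sum. -/
theorem sum_boxCard_le (p : ℕ) [Fact p.Prime] (S R : ℕ → ℕ) (hS : ∀ i, 1 ≤ S i) (n : ℕ) :
    ∑ j ∈ Finset.range (n + 1), boxCard p S R (j + 1) ≤ 2 * boxCard p S R (n + 1) := by
  have hp : p.Prime := Fact.out
  induction n with
  | zero => simp; omega
  | succ n ih =>
    rw [Finset.sum_range_succ]
    have h1 : 2 * boxCard p S R (n + 1) ≤ boxCard p S R (n + 1 + 1) := by
      rw [boxCard_succ _ _ _ (n + 1), mul_comm]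
      refine Nat.mul_le_mul_left _ ?_
      have h2 : p ^ 1 ≤ p ^ S (n + 1) := Nat.pow_le_pow_right hp.pos (hS _)
      have h3 := hp.two_le
      have h4 : 1 ≤ p ^ R (n + 1) := Nat.pow_pos hp.pos
      rw [pow_one] at h2
      nlinarith [Nat.mul_le_mul h4 h4, Nat.mul_le_mul (h3.trans h2) (Nat.mul_le_mul h4 h4)]
    omega

/-- The upper bound for the growth with respect to the standard generators. -/
theorem growth_le_boxCard (hpos : ∀ a, 1 ≤ bound S R a) {B : ℕ} (hB : ∀ a, bound S R a ≤ B)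
    {m n : ℕ} (hm : m ≤ scale p S R n) :
    growth K p (gens K p S R) m ≤ 6 * B * boxCard p S R (n + 2) := by
  have hp : p.Prime := Fact.out
  let α : Fin 3 → ℕ → Var := ![Var.x, Var.y, Var.z]
  let β : Fin 3 → ℕ → Var := ![Var.y, Var.x, Var.x]
  let D : Fin 3 → ℕ → Derivation K (Alg K p S R) (Alg K p S R) :=
    ![v K p S R, w K p S R, u K p S R]
  have hD : ∀ j, IsPivot (α j) (β j) (D j) := by
    intro j
    fin_cases j
    exacts [isPivot_v K p S R, isPivot_w K p S R, isPivot_u K p S R]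
  have hb : ∀ j i, p ^ bound S R (α j i) + p ^ bound S R (β j i) = p ^ S i + p ^ R i := by
    intro j i
    fin_cases j
    exacts [rfl, add_comm _ _, add_comm _ _]
  have hgens : gens K p S R = Set.range fun j => (D j 0).toLinearMap := by
    ext A
    simp [gens, D, Fin.exists_fin_succ, eq_comm]
  have hα : ∀ n, Function.Injective fun j => α j n := by
    intro n i j hij
    fin_cases i <;> fin_cases j <;> simp_all [α]
  have hsurj : ∀ a : Var, ∃ j, α j a.idx = a := by
    intro a
    cases a
    exacts [⟨0, rfl⟩, ⟨1, rfl⟩, ⟨2, rfl⟩]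
  have htri : growthSpace K p (gens K p S R) m ≤ triangular K p S R := by
    refine isRestrictedFiltration_triangular.growthSpace_le ?_ m
    rw [hgens]
    rintro _ ⟨j, rfl⟩
    exact ⟨toLinearMap_mem_derSubmodule _, fun n f hf => (hD j).mem_below 0 hf⟩
  have hinj : ∀ A ∈ growthSpace K p (gens K p S R) m,
      (∀ f ∈ subspace K p (bound S R) (below (n + 2)), A f = 0) → A = 0 := by
    intro A hA h
    have h1 : growthSpace K p (gens K p S R) m ≤
        affineSpace K p S R (fun j => (D j (n + 1)).toLinearMap) (n + 1) m := by
      refine Submodule.span_le.2 ?_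
      rintro _ ⟨l, k, hl0, hl, hlk, rfl⟩
      -- Passing to level n + 1 leaves room for words of length up to `scale n`; level n itself need
      -- not.
      have h2 := wt_full_add_le p S R (fun i => hpos (.x i)) n
      have h3 := Submodule.pow_mem_pow _ (rightNormed_mem_pow (K := K) hl0 hl) (p ^ k)
      rw [← pow_mul, hgens] at h3
      exact affineSpace_mono _ _ (by exact_mod_cast hlk)
        (pow_span_le_affineSpace hD hb _ (by omega) h3)
    exact affineSpace_eq_zero hD hpos (hα (n + 1)) (h1 hA) (htri hA).1 h
  -- One coordinate for each generation i < n + 2, letter and k < B: the value at t^{(p^k)}, which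
  -- triangularity confines to generations ≤ i. Where k is not below the bound of t, the monomial is
  -- 0 by convention, which is harmless.
  let M : Fin (n + 2) × (Fin 3 × Fin B) → Submodule K (Alg K p S R) := fun i =>
    subspace K p (bound S R) (below (i.1 + 1))
  have hM : ∀ i, FiniteDimensional K (M i) := fun i => (finrank_subspace_below _).1
  let t : Fin (n + 2) × (Fin 3 × Fin B) → Alg K p S R := fun i =>
    mono K p (bound S R) (Finsupp.single (α i.2.1 i.1) (p ^ (i.2.2 : ℕ)))
  have ht : ∀ i, t i ∈ subspace K p (bound S R) (below (i.1 + 1)) := fun i =>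
    mono_mem_subspace fun a ha => by
      rcases eq_or_ne (α i.2.1 i.1) a with rfl | h'
      · exact ((hD i.2.1).idx_left i.1).trans_lt (Nat.lt_succ_self _)
      · simp [h'] at ha
  let Φ : growthSpace K p (gens K p S R) m →ₗ[K] (∀ i, M i) :=
    LinearMap.pi fun i => LinearMap.codRestrict (M i)
      ((LinearMap.applyₗ (t i)).comp (Submodule.subtype _))
      fun A => (htri A.2).2 _ _ (ht i)
  have hΦ : Function.Injective Φ := by
    rw [← LinearMap.ker_eq_bot, LinearMap.ker_eq_bot']
    rintro ⟨A, hA⟩ h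
    refine Subtype.ext (hinj A hA fun f hf => ?_)
    refine derSubmodule_eq_zero (htri hA).1 (fun a ha k hk => ?_) hf
    obtain ⟨j, hj⟩ := hsurj a
    have h1 := congrArg Subtype.val
      (congrFun h (⟨a.idx, ha⟩, j, ⟨k, hk.trans_le (hB a)⟩))
    change A (mono K p (bound S R) (Finsupp.single (α j a.idx) (p ^ k))) = 0 at h1
    rwa [hj] at h1
  have h1 := LinearMap.finrank_le_finrank_of_injective hΦ
  rw [Module.finrank_pi_fintype, Fintype.sum_prod_type] at h1
  refine h1.trans ?_
  calc ∑ i : Fin (n + 2), ∑ j : Fin 3 × Fin B, Module.finrank K (M (i, j))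
      ≤ ∑ i : Fin (n + 2), ∑ j : Fin 3 × Fin B, boxCard p S R (i + 1) :=
        Finset.sum_le_sum fun i _ => Finset.sum_le_sum fun j _ => (finrank_subspace_below _).2
    _ = 3 * B * ∑ i ∈ Finset.range (n + 2), boxCard p S R (i + 1) := by
        simp [Finset.mul_sum, Finset.sum_range]
    _ ≤ 3 * B * (2 * boxCard p S R (n + 2)) :=
        Nat.mul_le_mul_left _ (sum_boxCard_le p S R (fun i => hpos (.x i)) (n + 1))
    _ = _ := by ring

end

end Clover

end

/-! ### Periodicity and asymptotics -/

namespace Clover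

theorem prod_range_periodic {M : Type*} [CommMonoid M] {f : ℕ → M} {N : ℕ}
    (hf : ∀ i, f (i + N) = f i) (k j : ℕ) :
    ∏ i ∈ Finset.range (k * N + j), f i =
      (∏ i ∈ Finset.range N, f i) ^ k * ∏ i ∈ Finset.range j, f i := by
  induction k with
  | zero => simp
  | succ k ih =>
    rw [show (k + 1) * N + j = N + (k * N + j) by ring, Finset.prod_range_add,
      Finset.prod_congr rfl fun i _ => show f (N + i) = f i by rw [add_comm, hf], ih, pow_succ',
      mul_assoc]

section

variable {p : ℕ} {S R : ℕ → ℕ} {N : ℕ}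

theorem scale_periodic (hS : ∀ i, S (i + N) = S i) (hR : ∀ i, R (i + N) = R i) (k j : ℕ) :
    scale p S R (k * N + j) = scale p S R N ^ k * scale p S R j :=
  prod_range_periodic (fun i => by rw [hS, hR]) k j

theorem boxCard_periodic (hS : ∀ i, S (i + N) = S i) (hR : ∀ i, R (i + N) = R i) (k j : ℕ) :
    boxCard p S R (k * N + j) = boxCard p S R N ^ k * boxCard p S R j := by
  simp only [boxCard, ← Finset.prod_pow_eq_pow_sum]
  exact prod_range_periodic (fun i => by rw [hS, hR]) k j

theorem exists_bound (hN : 1 ≤ N) (hS : ∀ i, S (i + N) = S i) (hR : ∀ i, R (i + N) = R i) :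
    ∃ B, 1 ≤ B ∧ ∀ a, bound S R a ≤ B := by
  have h1 : ∀ f : ℕ → ℕ, (∀ i, f (i + N) = f i) → ∀ i, f i ≤ ∑ j ∈ Finset.range N, f j := by
    intro f hf i
    rw [← Function.Periodic.map_mod_nat (f := f) hf i]
    exact Finset.single_le_sum (f := f) (fun _ _ => Nat.zero_le _)
      (Finset.mem_range.2 (Nat.mod_lt i hN))
  refine ⟨1 + ∑ j ∈ Finset.range N, S j + ∑ j ∈ Finset.range N, R j, by omega, fun a => ?_⟩
  cases a with
  | x i => have := h1 S hS i; simp only [bound]; omega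
  | y i => have := h1 R hR i; simp only [bound]; omega
  | z i => have := h1 R hR i; simp only [bound]; omega

end

theorem exists_bounds_of_geometric {g : ℕ → ℕ} (hg : Monotone g) {M c c' : ℕ} {C lam : ℝ}
    (hM : 2 ≤ M) (hc : 1 ≤ c) (hc' : 1 ≤ c') (hC : 0 < C) (hlam : 0 ≤ lam)
    (hone : ∀ m, 1 ≤ m → 1 ≤ g m)
    (hU : ∀ m k : ℕ, c * m ≤ M ^ k → (g m : ℝ) ≤ C * ((M : ℝ) ^ lam) ^ k)
    (hL : ∀ k : ℕ, ((M : ℝ) ^ lam) ^ k ≤ g (c' * M ^ k)) :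
    ∃ C₁ C₂ : ℝ, 0 < C₁ ∧ 0 < C₂ ∧ ∀ m : ℕ, 1 ≤ m →
      C₁ * (m : ℝ) ^ lam < (g m : ℝ) ∧ (g m : ℝ) < C₂ * (m : ℝ) ^ lam := by
  have hM0 : (0 : ℝ) < M := by positivity
  have hc0 : (0 : ℝ) < c := by positivity
  have hc'0 : (0 : ℝ) < c' := by positivity
  have hpow : ∀ k : ℕ, ((M : ℝ) ^ lam) ^ k = ((M ^ k : ℕ) : ℝ) ^ lam := by
    intro k
    rw [← Real.rpow_natCast, ← Real.rpow_mul hM0.le, mul_comm, Real.rpow_mul hM0.le,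
      Real.rpow_natCast, Nat.cast_pow]
  -- Sandwiching m between consecutive powers of M loses the factor M; the 1/2 and the + 1 make the
  -- inequalities strict.
  refine ⟨1 / 2 / ((c' : ℝ) * M) ^ lam, C * (M : ℝ) ^ lam * (c : ℝ) ^ lam + 1, by positivity,
    by positivity, fun m hm => ⟨?_, ?_⟩⟩
  · have hm0 : (0 : ℝ) < m := by positivity
    have hmp : (0 : ℝ) < (m : ℝ) ^ lam := by positivity
    have hg0 : (1 : ℝ) ≤ g m := by exact_mod_cast hone m hm
    have key : ((m : ℝ) / (c' * M)) ^ lam ≤ g m := by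
      -- For m < c' no value c' M^k lies below m, and the bound 1 ≤ g m is used instead.
      rcases lt_or_ge m c' with h | h
      · refine le_trans (Real.rpow_le_one (by positivity) ?_ hlam) hg0
        rw [div_le_one (by positivity)]
        have : m ≤ c' * M := h.le.trans (Nat.le_mul_of_pos_right _ (by omega))
        exact_mod_cast this
      · obtain ⟨n, hn1, hn2⟩ := exists_nat_pow_near (x := m / c') (y := M)
          ((Nat.one_le_div_iff hc').2 h) (by omega)
        have h1 : c' * M ^ n ≤ m := (Nat.mul_le_mul_left _ hn1).trans (Nat.mul_div_le m c')
        have h2 : m < c' * M ^ (n + 1) := by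
          rw [Nat.div_lt_iff_lt_mul hc'] at hn2
          rwa [mul_comm]
        have h3 := (hL n).trans (Nat.cast_le.2 (hg h1))
        rw [hpow] at h3
        refine le_trans (Real.rpow_le_rpow (by positivity) ?_ hlam) h3
        rw [div_le_iff₀ (by positivity)]
        have h4 : m ≤ M ^ n * (c' * M) := by rw [pow_succ] at h2; nlinarith
        exact_mod_cast h4
    rw [Real.div_rpow hm0.le (by positivity)] at key
    have h5 : 1 / 2 / ((c' : ℝ) * M) ^ lam * (m : ℝ) ^ lam =
        1 / 2 * ((m : ℝ) ^ lam / ((c' : ℝ) * M) ^ lam) := by ring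
    rw [h5]
    have h6 : 0 < (m : ℝ) ^ lam / ((c' : ℝ) * M) ^ lam := by positivity
    linarith
  · have hmp : (0 : ℝ) < (m : ℝ) ^ lam := by positivity
    obtain ⟨n, hn1, hn2⟩ := exists_nat_pow_near (x := c * m) (y := M) (Nat.mul_pos hc hm)
      (by omega)
    have h1 := hU m (n + 1) hn2.le
    have h2 : ((M ^ n : ℕ) : ℝ) ^ lam ≤ (c : ℝ) ^ lam * (m : ℝ) ^ lam := by
      rw [← Real.mul_rpow (by positivity) (by positivity)]
      exact Real.rpow_le_rpow (by positivity) (by exact_mod_cast hn1) hlam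
    rw [pow_succ', hpow] at h1
    have h3 : C * ((M : ℝ) ^ lam * ((M ^ n : ℕ) : ℝ) ^ lam) ≤
        C * ((M : ℝ) ^ lam * ((c : ℝ) ^ lam * (m : ℝ) ^ lam)) := by gcongr
    nlinarith

theorem tendsto_log_div_log {g : ℕ → ℕ} {C₁ C₂ lam : ℝ} (h1 : 0 < C₁)
    (h : ∀ m : ℕ, 1 ≤ m → C₁ * (m : ℝ) ^ lam < (g m : ℝ) ∧ (g m : ℝ) < C₂ * (m : ℝ) ^ lam) :
    Tendsto (fun m : ℕ => Real.log (g m) / Real.log m) atTop (nhds lam) := by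
  have hlog : Tendsto (fun m : ℕ => Real.log m) atTop atTop :=
    Real.tendsto_log_atTop.comp tendsto_natCast_atTop_atTop
  have hlim : ∀ c : ℝ, Tendsto (fun m : ℕ => c / Real.log m + lam) atTop (nhds lam) := by
    intro c
    simpa using (hlog.const_div_atTop c).add_const lam
  refine tendsto_of_tendsto_of_tendsto_of_le_of_le' (hlim (Real.log C₁)) (hlim (Real.log C₂)) ?_ ?_
  · filter_upwards [eventually_ge_atTop 2] with m hm
    have hm0 : (0 : ℝ) < m := by positivity
    have hlm : 0 < Real.log m := Real.log_pos (by exact_mod_cast hm)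
    have h2 := Real.log_le_log (by positivity) (h m (by omega)).1.le
    rw [Real.log_mul h1.ne' (by positivity), Real.log_rpow hm0] at h2
    rw [le_div_iff₀ hlm, add_mul, div_mul_cancel₀ _ hlm.ne']
    exact h2
  · filter_upwards [eventually_ge_atTop 2] with m hm
    have hm0 : (0 : ℝ) < m := by positivity
    have hlm : 0 < Real.log m := Real.log_pos (by exact_mod_cast hm)
    have hmp : (0 : ℝ) < (m : ℝ) ^ lam := by positivity
    obtain ⟨ha, hb⟩ := h m (by omega)
    have hg : (0 : ℝ) < g m := lt_trans (by positivity) ha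
    have hC2 : 0 < C₂ := pos_of_mul_pos_left (hg.trans hb) hmp.le
    have h2 := Real.log_le_log hg hb.le
    rw [Real.log_mul hC2.ne' hmp.ne', Real.log_rpow hm0] at h2
    rw [div_le_iff₀ hlm, add_mul, div_mul_cancel₀ _ hlm.ne']
    exact h2

section

variable {K : Type*} [Field K] {A : Type*} [Ring A] [Algebra K A] {p : ℕ} [Fact p.Prime]
  {X : Set A}

theorem growth_le_of_le (hX : X.Finite) {Y : Set A} {m n : ℕ}
    (h : growthSpace K p Y m ≤ growthSpace K p X n) : growth K p Y m ≤ growth K p X n :=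
  have := finiteDimensional_growthSpace (K := K) p hX n
  Submodule.finrank_mono h

/-- If the growth space vanished at some m ≥ 1, then X would lie in the zero filtration, and so
would every growth space. -/
theorem one_le_growth (hX : X.Finite) {n : ℕ} (h : growth K p X n ≠ 0) {m : ℕ} (hm : 1 ≤ m) :
    1 ≤ growth K p X m := by
  have hp : p.Prime := Fact.out
  by_contra h0
  have hfin := finiteDimensional_growthSpace (K := K) p hX m
  have hbot : growthSpace K p X m = ⊥ :=
    Submodule.finrank_eq_zero.1 (show growth K p X m = 0 by omega)
  have hF : IsRestrictedFiltration (K := K) (A := A) p fun _ => ⊥ :=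
    { mono := fun _ _ _ => le_rfl
      lie_mem := fun ha _ => by
        rw [Submodule.mem_bot] at *
        rw [ha, ring_zero_lie]
      pow_mem := fun ha => by
        rw [Submodule.mem_bot] at *
        rw [ha, zero_pow hp.ne_zero] }
  have h1 := hF.growthSpace_le (X := X)
    (fun x hx => hbot ▸ growthSpace_mono p X hm (subset_growthSpace_one X hx)) n
  rw [le_bot_iff] at h1
  exact h (by rw [growth, h1, finrank_bot])

end

end Clover

theorem theorem5p3 {K : Type*} [Field K] (p : ℕ) [Fact p.Prime] [CharP K p]
    (S R : ℕ → ℕ) (hS : ∀ i, 1 ≤ S i) (hR : ∀ i, 1 ≤ R i)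
    (N : ℕ) (hN : 1 ≤ N) (hSN : ∀ i, S (i + N) = S i) (hRN : ∀ i, R (i + N) = R i)
    (μ σ lam : ℝ)
    (hμ : μ = ∏ i ∈ Finset.range N, ((p : ℝ) ^ S i + (p : ℝ) ^ R i - 1))
    (hσ : σ = ∑ i ∈ Finset.range N, ((S i : ℝ) + 2 * (R i : ℝ)))
    (hlam : lam = σ * Real.log p / Real.log μ) :
    (∀ X : Set (Module.End K (Clover.Alg K p S R)), X.Finite →
      Clover.lieP K p X = Clover.clover K p S R →
        Clover.gkDim K p X = (lam : EReal) ∧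
        Clover.lowerGKDim K p X = (lam : EReal) ∧
        ∃ C₁ C₂ : ℝ, 0 < C₁ ∧ 0 < C₂ ∧ ∀ m : ℕ, 1 ≤ m →
          C₁ * (m : ℝ) ^ lam < (Clover.growth K p X m : ℝ) ∧
          (Clover.growth K p X m : ℝ) < C₂ * (m : ℝ) ^ lam) ∧
    lam ∈ Set.Icc (1 : ℝ) 3 := by
  open Clover in
  have hp : p.Prime := Fact.out
  have hp0 : (0 : ℝ) < p := by exact_mod_cast hp.pos
  have hpos : ∀ a, 1 ≤ bound S R a := by
    intro a
    cases a
    exacts [hS _, hR _, hR _]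
  have h2 : ∀ k, 1 ≤ k → 2 ≤ p ^ k := fun k hk => by
    have h := Nat.pow_le_pow_right hp.pos hk
    have := hp.two_le
    rw [pow_one] at h
    omega
  set M := scale p S R N with hM
  have hμM : μ = M := by
    rw [hμ, hM, scale, Nat.cast_prod]
    refine Finset.prod_congr rfl fun i _ => ?_
    have := h2 _ (hS i)
    rw [Nat.cast_sub (by omega)]
    push_cast
    ring
  have hM2 : 2 ≤ M := by
    obtain ⟨N, rfl⟩ : ∃ n, N = n + 1 := ⟨N - 1, by omega⟩
    rw [hM, scale_succ]
    have h3 := scale_pos p S R N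
    have h4 := h2 _ (hS N)
    have h5 := h2 _ (hR N)
    exact (show 2 ≤ p ^ S N + p ^ R N - 1 by omega).trans (Nat.le_mul_of_pos_left _ h3)
  have hM0 : (0 : ℝ) < M := by positivity
  have hlogM : 0 < Real.log M := Real.log_pos (by exact_mod_cast hM2)
  -- The definition of λ says exactly μ^λ = p^σ.
  have hbox : (boxCard p S R N : ℝ) = (M : ℝ) ^ lam := by
    rw [Real.rpow_def_of_pos hM0, hlam, hμM, mul_div_cancel₀ _ hlogM.ne', mul_comm,
      ← Real.rpow_def_of_pos hp0]
    have hσN : σ = ((∑ i ∈ Finset.range N, (S i + 2 * R i) : ℕ) : ℝ) := by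
      rw [hσ]; push_cast; rfl
    rw [hσN, Real.rpow_natCast, boxCard, Nat.cast_pow]
  -- Factor by factor, with a = p^{S_i} and b = p^{R_i} at least 2: a + b - 1 ≤ ab² here, and ab² ≤
  -- (a + b - 1)³ next. Hence μ ≤ μ^λ ≤ μ³.
  have hle1 : M ≤ boxCard p S R N := by
    rw [hM, boxCard, scale, ← Finset.prod_pow_eq_pow_sum]
    refine Finset.prod_le_prod' fun i _ => ?_
    have h4 := h2 _ (hS i)
    have h5 := h2 _ (hR i)
    rw [pow_add, pow_mul', sq]
    have h6 : p ^ S i + p ^ R i ≤ p ^ S i * p ^ R i := by nlinarith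
    have h7 : p ^ S i * p ^ R i ≤ p ^ S i * (p ^ R i * p ^ R i) :=
      Nat.mul_le_mul_left _ (Nat.le_mul_of_pos_left _ (by omega))
    omega
  have hle3 : boxCard p S R N ≤ M ^ 3 := by
    rw [hM, boxCard, scale, ← Finset.prod_pow_eq_pow_sum, ← Finset.prod_pow]
    refine Finset.prod_le_prod' fun i _ => ?_
    have h4 := h2 _ (hS i)
    have h5 := h2 _ (hR i)
    rw [pow_add, pow_mul', sq, pow_succ, sq, mul_comm (p ^ S i)]
    exact Nat.mul_le_mul (Nat.mul_le_mul (by omega) (by omega)) (by omega)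
  have hM1 : (1 : ℝ) < M := by exact_mod_cast hM2
  have hlam1 : 1 ≤ lam := by
    rw [← Real.rpow_le_rpow_left_iff hM1, Real.rpow_one, ← hbox]
    exact_mod_cast hle1
  have hlam3 : lam ≤ 3 := by
    rw [← Real.rpow_le_rpow_left_iff hM1, ← hbox]
    exact_mod_cast hle3
  refine ⟨fun X hX hXT => ?_, hlam1, hlam3⟩
  have hgfin : (gens K p S R).Finite := by simp [gens]
  obtain ⟨B, hB1, hB⟩ := exists_bound hN hSN hRN
  obtain ⟨c, hc, hXg⟩ := exists_growthSpace_le (K := K) (p := p) hX hXT.le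
  obtain ⟨c', hc', hgX⟩ := exists_growthSpace_le (K := K) (p := p) hgfin hXT.ge
  have hmono : Monotone (growth K p X) := fun m n h =>
    growth_le_of_le hX (growthSpace_mono p X h)
  -- Use the lower bound at n = kN. The extra generation costs only the constant factor `scale 1`,
  -- since `scale (kN + 1)` = M^k · `scale 1`.
  have hL : ∀ k : ℕ, ((M : ℝ) ^ lam) ^ k ≤
      growth K p X (c' * (3 * scale p S R 1) * M ^ k) := by
    intro k
    have h3 := boxCard_le_growth (K := K) (p := p) hpos (k * N)
    have h4 := growth_le_of_le hX (hgX (3 * scale p S R (k * N + 1)))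
    rw [scale_periodic hSN hRN] at h3 h4
    have h5 : boxCard p S R (k * N) = boxCard p S R N ^ k := by
      have := boxCard_periodic (p := p) hSN hRN k 0
      rwa [add_zero, show boxCard p S R 0 = 1 from rfl, mul_one] at this
    rw [← hbox, ← Nat.cast_pow, ← h5]
    refine Nat.cast_le.2 (h3.trans (h4.trans_eq ?_))
    rw [← hM]
    congr 1
    ring
  -- Use the upper bound at n = kN; its two extra generations contribute the constant factor
  -- `boxCard 2`.
  have hU : ∀ m k : ℕ, c * m ≤ M ^ k → (growth K p X m : ℝ) ≤
      ((6 * B * boxCard p S R 2 : ℕ) : ℝ) * ((M : ℝ) ^ lam) ^ k := by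
    intro m k hmk
    have h3 : scale p S R (k * N) = M ^ k := by
      have := scale_periodic (p := p) hSN hRN k 0
      rwa [add_zero, scale_zero, mul_one] at this
    have h4 := (growth_le_of_le hgfin (hXg m)).trans
      (growth_le_boxCard (K := K) hpos hB (hmk.trans h3.ge))
    rw [boxCard_periodic hSN hRN] at h4
    rw [← hbox, ← Nat.cast_pow, ← Nat.cast_mul]
    refine Nat.cast_le.2 (h4.trans_eq ?_)
    ring
  have hone : ∀ m, 1 ≤ m → 1 ≤ growth K p X m := fun m hm => by
    refine one_le_growth hX (n := c' * (3 * scale p S R 1) * M ^ 0) (fun h0 => ?_) hm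
    have h3 := hL 0
    rw [h0, pow_zero] at h3
    norm_num at h3
  have hbox2 : 0 < boxCard p S R 2 := Nat.pow_pos hp.pos
  obtain ⟨C₁, C₂, hC₁, hC₂, hC⟩ := exists_bounds_of_geometric hmono hM2 hc
    (Nat.mul_pos hc' (Nat.mul_pos (by norm_num) (scale_pos p S R 1)))
    (by exact_mod_cast Nat.mul_pos (Nat.mul_pos (by norm_num) hB1) hbox2) (by linarith) hone hU hL
  have hlim : Tendsto (fun m : ℕ => ((Real.log (growth K p X m) / Real.log m : ℝ) : EReal)) atTop
      (nhds (lam : EReal)) :=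
    (continuous_coe_real_ereal.tendsto lam).comp (tendsto_log_div_log hC₁ hC)
  exact ⟨hlim.limsup_eq, hlim.liminf_eq, C₁, C₂, hC₁, hC₂, hC⟩
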